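/- Let $n\ge 1$, let $\Omega\subset\mathbb R^n$ be a nonempty bounded open set, and let $A=-\Delta$ be the Dirichlet Laplacian on the complex Hilbert space $L^2(\Omega)$ (norm $\|\cdot\|$), with domain $D(A)=\{u\in H^1_0(\Omega):\Delta u\in L^2(\Omega)\}$ (which is $H^2(\Omega)\cap H^1_0(\Omega)$ when $\partial\Omega$ is smooth). $A$ is positive and self-adjoint with compact inverse; its real powers $A^s$ are defined through its eigenvalue expansion. Let $\alpha,\beta,\gamma,\kappa>0$ and $\tau\in(0,1]$, and let $$\mathbb H=D(A)\times D(A^{\tau/2})\times L^2(\Omega),\qquad \|(u,v,\theta)\|_{\mathbb H}^2=\beta\|Au\|^2+\beta\big(\|v\|^2+\gamma\|A^{\tau/2}v\|^2\big)+\alpha\|\theta\|^2 .$$ Let $\mathbb B$ be the operator of the hinged thermoelastic plate $u_{tt}+\gamma A^\tau u_{tt}+A^2u-\alpha A\theta=0$, $\theta_t+\kappa A\theta+\beta Au_t=0$ in $\mathbb H$, that is, $$\mathbb B(u,v,\theta)=\big(v,\;(I+\gamma A^\tau)^{-1}(-A^2u+\alpha A\theta),\;-\kappa A\theta-\beta Av\big),$$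 $$D(\mathbb B)=\{(u,v,\theta)\in\mathbb H: v\in D(A),\ -Au+\alpha\theta\in D(A^{1-\tau/2}),\ -\kappa\theta-\beta v\in D(A)\},$$ where $-A^2u+\alpha A\theta=A(-Au+\alpha\theta)$ is understood in $D(A^{-\tau/2})$, the dual of $D(A^{\tau/2})$, and $I+\gamma A^\tau$ as the isomorphism $D(A^{\tau/2})\to D(A^{-\tau/2})$ given by $\langle (I+\gamma A^\tau)z_1,z_2\rangle=\langle z_1,z_2\rangle+\gamma\langle A^{\tau/2}z_1,A^{\tau/2}z_2\rangle$. Then $\mathbb B$ generates a $C_0$-semigroup $S(t)=e^{\mathbb Bt}$ on $\mathbb H$, and this semigroup is not analytic: there are no $\varphi\in(0,\pi/2]$ and no family of bounded operators $T(z)$ on $\mathbb H$, indexed by the sector $\Sigma_\varphi=\{z\neq 0:|\arg z|<\varphi\}$, that is holomorphic in $z$ for the operator norm, agrees with $S$ on $(0,\infty)$, satisfies $T(z+w)=T(z)T(w)$ on $\Sigma_\varphi$, and satisfies $T(z)U\to U$ as $z\to0$ in $\Sigma_\varphi$ for every $U\in\mathbb H$. -/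

import Mathlib

open MeasureTheory Filter Topology Set
open scoped ContDiff InnerProductSpace ComplexConjugate

/-! ### Strongly continuous semigroups, generators, analyticity -/

/-- A strongly continuous (`C₀`) semigroup of bounded linear operators on `X`. -/
structure StronglyContinuousSemigroup (X : Type*) [NormedAddCommGroup X] [NormedSpace ℂ X] where
  /-- the operator `S(t)`, `t ≥ 0` -/
  op : NNReal → X →L[ℂ] X
  map_zero : op 0 = ContinuousLinearMap.id ℂ X
  map_add : ∀ s t, op (s + t) = (op s).comp (op t)
  continuous_orbit : ∀ x, Continuous fun t => op t x

namespace StronglyContinuousSemigroup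

variable {X : Type*} [NormedAddCommGroup X] [NormedSpace ℂ X]

/-- `B` is the infinitesimal generator of `S`: `x ∈ D(B)` and `B x = y` if and only if
`(S(t) x - x) / t → y` in norm as `t → 0+`. -/
def IsGeneratedBy (S : StronglyContinuousSemigroup X) (B : X →ₗ.[ℂ] X) : Prop :=
  ∀ x y : X, (x, y) ∈ B.graph ↔
    Tendsto (fun t : NNReal => ((t : ℂ))⁻¹ • (S.op t x - x)) (𝓝[>] 0) (𝓝 y)

/-- The open sector `{z ≠ 0 : |arg z| < φ}`. -/
def sector (φ : ℝ) : Set ℂ := {z | z ≠ 0 ∧ |z.arg| < φ}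

/-- `S` is an analytic semigroup: on some sector around the positive half-line it extends to a
family of bounded operators that is holomorphic for the operator norm, has the semigroup
property, and tends strongly to the identity at the vertex. -/
def IsAnalytic (S : StronglyContinuousSemigroup X) : Prop :=
  ∃ φ : ℝ, 0 < φ ∧ φ ≤ Real.pi / 2 ∧ ∃ T : ℂ → X →L[ℂ] X,
    DifferentiableOn ℂ T (sector φ) ∧
    (∀ t : NNReal, 0 < t → T (t : ℂ) = S.op t) ∧
    (∀ z ∈ sector φ, ∀ w ∈ sector φ, T (z + w) = (T z).comp (T w)) ∧
    ∀ x, Tendsto (fun z => T z x) (𝓝[sector φ] 0) (𝓝 x)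

end StronglyContinuousSemigroup

/-! ### Real powers of a positive operator with discrete spectrum -/

namespace LinearPMap

variable {H : Type*} [NormedAddCommGroup H] [InnerProductSpace ℂ H]

/-- The eigenspace `{x ∈ D(A) : A x = σ x}`. -/
def eigSpace (A : H →ₗ.[ℂ] H) (σ : ℝ) : Submodule ℂ H where
  carrier := {x | (x, (σ : ℂ) • x) ∈ A.graph}
  add_mem' {x y} hx hy := by simpa [smul_add] using A.graph.add_mem hx hy
  zero_mem' := by
    change ((0 : H), (σ : ℂ) • (0 : H)) ∈ A.graph
    rw [smul_zero]
    exact A.graph.zero_mem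
  smul_mem' c x hx := by
    change (c • x, (σ : ℂ) • c • x) ∈ A.graph
    rw [smul_comm]
    exact A.graph.smul_mem c hx

variable [CompleteSpace H]

/-- The orthogonal projection onto the (closure of the) eigenspace of `A` for `σ`; it is zero
unless `σ` is an eigenvalue. -/
noncomputable def eigProj (A : H →ₗ.[ℂ] H) (σ : ℝ) : H →L[ℂ] H :=
  (A.eigSpace σ).topologicalClosure.starProjection

/-- The power `A ^ s` of a positive self-adjoint operator with compact inverse:
`A ^ s x = ∑ σ ^ s P_σ x`, the sum being over the eigenvalues `σ` of `A` (for every other `σ`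
the term vanishes), on the domain of all `x` for which this orthogonal series converges. -/
noncomputable def realPow (A : H →ₗ.[ℂ] H) (s : ℝ) : H →ₗ.[ℂ] H where
  domain :=
    { carrier := {x | Summable fun σ : ℝ => ((σ ^ s : ℝ) : ℂ) • A.eigProj σ x}
      add_mem' := fun {x y} hx hy => by simpa [smul_add] using Summable.add hx hy
      zero_mem' := by simp
      smul_mem' := fun c x hx => by
        simpa [smul_comm c] using Summable.const_smul c hx }
  toFun :=
    { toFun := fun x => ∑' σ : ℝ, ((σ ^ s : ℝ) : ℂ) • A.eigProj σ (x : H)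
      map_add' := fun x y => by
        simpa [smul_add] using Summable.tsum_add x.2 y.2
      map_smul' := fun c x => by
        simpa [smul_comm c] using Summable.tsum_const_smul c x.2 }

end LinearPMap

/-! ### The Dirichlet Laplacian -/

/-- A nonempty bounded open subset of `ℝⁿ`. -/
structure PlateDomain (n : ℕ) where
  carrier : Set (EuclideanSpace ℝ (Fin n))
  isOpen : IsOpen carrier
  isBounded : Bornology.IsBounded carrier
  nonempty : carrier.Nonempty

namespace PlateDomain

variable {n : ℕ} (Ω : PlateDomain n)

/-- The complex Hilbert space `L²(Ω)`. -/
abbrev L2 : Type := Lp ℂ 2 (volume.restrict Ω.carrier)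

/-- `φ ∈ C_c^∞(Ω)`. -/
def IsTest (φ : EuclideanSpace ℝ (Fin n) → ℂ) : Prop :=
  ContDiff ℝ ∞ φ ∧ HasCompactSupport φ ∧ tsupport φ ⊆ Ω.carrier

/-- The partial derivative `∂ᵢφ`. -/
noncomputable def pderiv (φ : EuclideanSpace ℝ (Fin n) → ℂ) (i : Fin n)
    (x : EuclideanSpace ℝ (Fin n)) : ℂ :=
  fderiv ℝ φ x (EuclideanSpace.single i 1)

variable {Ω} in
theorem IsTest.pderiv {φ : EuclideanSpace ℝ (Fin n) → ℂ} (h : Ω.IsTest φ) (i : Fin n) :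
    Ω.IsTest (pderiv φ i) := by
  refine ⟨?_, h.2.1.fderiv_apply (𝕜 := ℝ) _, (tsupport_fderiv_apply_subset ℝ _).trans h.2.2⟩
  exact (h.1.fderiv_right (m := ∞) (by simp)).clm_apply contDiff_const

variable {Ω} in
theorem IsTest.memLp {φ : EuclideanSpace ℝ (Fin n) → ℂ} (h : Ω.IsTest φ) :
    MemLp φ 2 (volume.restrict Ω.carrier) :=
  h.1.continuous.memLp_of_hasCompactSupport h.2.1

/-- The pairs `(φ, ∇φ)` with `φ ∈ C_c^∞(Ω)`, as elements of `L²(Ω) × L²(Ω)ⁿ`. -/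
def testGraph : Submodule ℂ (Ω.L2 × (Fin n → Ω.L2)) where
  carrier := {p | ∃ φ, Ω.IsTest φ ∧ p.1 =ᵐ[volume.restrict Ω.carrier] φ ∧
    ∀ i, p.2 i =ᵐ[volume.restrict Ω.carrier] pderiv φ i}
  add_mem' := by
    rintro p q ⟨φ, hφ, hp, hp'⟩ ⟨ψ, hψ, hq, hq'⟩
    refine ⟨φ + ψ, ⟨hφ.1.add hψ.1, hφ.2.1.add hψ.2.1,
      (tsupport_add φ ψ).trans (union_subset hφ.2.2 hψ.2.2)⟩, ?_, fun i => ?_⟩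
    · exact (Lp.coeFn_add _ _).trans (hp.add hq)
    · refine (Lp.coeFn_add _ _).trans (((hp' i).add (hq' i)).trans (.of_forall fun x => ?_))
      simp only [PlateDomain.pderiv, Pi.add_apply]
      rw [fderiv_add (hφ.1.differentiable (by simp)).differentiableAt
        (hψ.1.differentiable (by simp)).differentiableAt]
      rfl
  zero_mem' := by
    refine ⟨0, ⟨contDiff_const, HasCompactSupport.zero, by simp [tsupport]⟩, ?_, fun i => ?_⟩
    · exact Lp.coeFn_zero _ _ _
    · refine (Lp.coeFn_zero _ _ _).trans (.of_forall fun x => ?_)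
      simp [PlateDomain.pderiv]
  smul_mem' := by
    rintro c p ⟨φ, hφ, hp, hp'⟩
    refine ⟨c • φ, ⟨hφ.1.const_smul c, hφ.2.1.smul_left (f := fun _ => c),
      (tsupport_smul_subset_right (fun _ => c) φ).trans hφ.2.2⟩, ?_, fun i => ?_⟩
    · exact (Lp.coeFn_smul _ _).trans (hp.const_smul c)
    · refine (Lp.coeFn_smul _ _).trans (((hp' i).const_smul c).trans (.of_forall fun x => ?_))
      simp only [PlateDomain.pderiv, Pi.smul_apply]
      rw [fderiv_const_smul (hφ.1.differentiable (by simp)).differentiableAt]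
      rfl

/-- The Sobolev space `H¹₀(Ω)`, as the set of all pairs `(u, ∇u)`: the closure of `C_c^∞(Ω)` for
the `H¹` norm. -/
noncomputable def sobolevH10 : Submodule ℂ (Ω.L2 × (Fin n → Ω.L2)) := Ω.testGraph.topologicalClosure

/-- The pairs `(u, f) ∈ L²(Ω)²` with `u ∈ H¹₀(Ω)` and `-Δu = f` in the sense of distributions:
`∫ ∇φ̄ · ∇u = ∫ φ̄ f` for all `φ ∈ C_c^∞(Ω)`. -/
def laplaceGraph : Submodule ℂ (Ω.L2 × Ω.L2) where
  carrier := {p | ∃ G : Fin n → Ω.L2, (p.1, G) ∈ Ω.sobolevH10 ∧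
    ∀ q ∈ Ω.testGraph, ∑ i, ⟪q.2 i, G i⟫_ℂ = ⟪q.1, p.2⟫_ℂ}
  add_mem' := by
    rintro p p' ⟨G, hG, h⟩ ⟨G', hG', h'⟩
    refine ⟨G + G', Ω.sobolevH10.add_mem hG hG', fun q hq => ?_⟩
    simp [inner_add_right, Finset.sum_add_distrib, h q hq, h' q hq]
  zero_mem' := ⟨0, Ω.sobolevH10.zero_mem, by simp⟩
  smul_mem' := by
    rintro c p ⟨G, hG, h⟩
    refine ⟨c • G, Ω.sobolevH10.smul_mem c hG, fun q hq => ?_⟩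
    simp [inner_smul_right, ← Finset.mul_sum, h q hq]

/-- The Dirichlet Laplacian `A = -Δ` on `L²(Ω)`, with domain
`D(A) = {u ∈ H¹₀(Ω) : Δu ∈ L²(Ω)}`. -/
noncomputable def dirichletLaplacian : Ω.L2 →ₗ.[ℂ] Ω.L2 := Ω.laplaceGraph.toLinearPMap

/-! The remaining facts of this section show that this is a well-defined injective operator. -/

variable {Ω} in
theorem inner_eq_integral {u v : Ω.L2} {φ ψ : EuclideanSpace ℝ (Fin n) → ℂ}
    (hu : u =ᵐ[volume.restrict Ω.carrier] φ) (hv : v =ᵐ[volume.restrict Ω.carrier] ψ)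
    (hφ : Ω.IsTest φ) : ⟪u, v⟫_ℂ = ∫ x, conj (φ x) * ψ x := by
  rw [L2.inner_def]
  rw [← setIntegral_eq_integral_of_forall_compl_eq_zero (s := Ω.carrier) (μ := volume)
    (f := fun x => conj (φ x) * ψ x)]
  · refine integral_congr_ae ?_
    filter_upwards [hu, hv] with x h1 h2
    rw [h1, h2]; simp [mul_comm]
  · intro x hx
    have : φ x = 0 := image_eq_zero_of_notMem_tsupport fun h => hx (hφ.2.2 h)
    simp [this]

theorem inner_test_grad {q : Ω.L2 × (Fin n → Ω.L2)} (hq : q ∈ Ω.testGraph)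
    {p : Ω.L2 × (Fin n → Ω.L2)} (hp : p ∈ Ω.sobolevH10) (i : Fin n) :
    ⟪q.1, p.2 i⟫_ℂ = -⟪q.2 i, p.1⟫_ℂ := by
  have hcl : IsClosed {p : Ω.L2 × (Fin n → Ω.L2) | ⟪q.1, p.2 i⟫_ℂ = -⟪q.2 i, p.1⟫_ℂ} :=
    isClosed_eq (by fun_prop) (by fun_prop)
  refine closure_minimal (s := (Ω.testGraph : Set (Ω.L2 × (Fin n → Ω.L2)))) ?_ hcl hp
  rintro p ⟨φ, hφ, h1, h2⟩
  obtain ⟨ψ, hψ, h3, h4⟩ := hq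
  change ⟪q.1, p.2 i⟫_ℂ = -⟪q.2 i, p.1⟫_ℂ
  rw [inner_eq_integral h3 (h2 i) hψ, inner_eq_integral (h4 i) h1 (hψ.pderiv i)]
  have hd : ∀ x, fderiv ℝ (fun y => conj (ψ y)) x (EuclideanSpace.single i 1)
      = conj (pderiv ψ i x) := fun x => by
    have := ((Complex.conjCLE : ℂ →L[ℝ] ℂ).hasFDerivAt.comp x
      (hψ.1.differentiable (by simp) x).hasFDerivAt).fderiv
    change fderiv ℝ ((Complex.conjCLE : ℂ →L[ℝ] ℂ) ∘ ψ) x _ = _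
    rw [this]; simp [PlateDomain.pderiv]
  have hcψ : ContDiff ℝ ∞ fun y => conj (ψ y) := (Complex.conjCLE : ℂ →L[ℝ] ℂ).contDiff.comp hψ.1
  have key := integral_mul_fderiv_eq_neg_fderiv_mul_of_integrable (𝕜 := ℂ) (μ := volume)
    (f := fun y => conj (ψ y)) (g := φ) (v := EuclideanSpace.single i 1) ?_ ?_ ?_
    (fun x _ => hcψ.differentiable (by simp) x) (fun x _ => hφ.1.differentiable (by simp) x)
  · simp only [hd] at key
    exact key
  · simp only [hd]
    refine Continuous.integrable_of_hasCompactSupport ?_ (hφ.2.1.mul_left)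
    exact (Complex.continuous_conj.comp (hψ.pderiv i).1.continuous).mul hφ.1.continuous
  · refine Continuous.integrable_of_hasCompactSupport ?_ ((hφ.pderiv i).2.1.mul_left)
    exact hcψ.continuous.mul (hφ.pderiv i).1.continuous
  · exact Continuous.integrable_of_hasCompactSupport
      (hcψ.continuous.mul hφ.1.continuous) hφ.2.1.mul_left

variable {Ω} in
theorem IsTest.mem_testGraph {φ : EuclideanSpace ℝ (Fin n) → ℂ} (h : Ω.IsTest φ) :
    ((h.memLp.toLp φ, fun i => (h.pderiv i).memLp.toLp _) : Ω.L2 × (Fin n → Ω.L2)) ∈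
      Ω.testGraph :=
  ⟨φ, h, h.memLp.coeFn_toLp, fun i => (h.pderiv i).memLp.coeFn_toLp⟩

/-- `C_c^∞(Ω)` is dense in `L²(Ω)`. -/
theorem eq_zero_of_inner_test {f : Ω.L2} (h : ∀ q ∈ Ω.testGraph, ⟪q.1, f⟫_ℂ = 0) : f = 0 := by
  have hf : LocallyIntegrableOn f Ω.carrier (volume : Measure (EuclideanSpace ℝ (Fin n))) := by
    have : IntegrableOn f Ω.carrier volume := by
      have : IsFiniteMeasure (volume.restrict Ω.carrier) :=
        ⟨by simpa using Ω.isBounded.measure_lt_top⟩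
      exact (Lp.memLp f).integrable (by norm_num)
    exact this.locallyIntegrableOn
  have := Ω.isOpen.ae_eq_zero_of_integral_contDiff_smul_eq_zero hf fun g hg hc hs => by
    have ht : Ω.IsTest fun x => (g x : ℂ) := by
      refine ⟨Complex.ofRealCLM.contDiff.comp hg, hc.comp_left (g := ((↑) : ℝ → ℂ)) rfl, ?_⟩
      exact (tsupport_comp_subset (g := ((↑) : ℝ → ℂ)) rfl g).trans hs
    have h0 := h _ ht.mem_testGraph
    rw [inner_eq_integral ht.memLp.coeFn_toLp (Filter.EventuallyEq.rfl) ht] at h0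
    simpa using h0
  rw [Lp.eq_zero_iff_ae_eq_zero]
  exact (ae_restrict_iff' Ω.isOpen.measurableSet).2 this

theorem laplaceGraph_snd_eq_zero (p : Ω.L2 × Ω.L2) (hp : p ∈ Ω.laplaceGraph) (h0 : p.1 = 0) :
    p.2 = 0 := by
  obtain ⟨G, hG, h⟩ := hp
  have hG0 : ∀ i, G i = 0 := fun i => Ω.eq_zero_of_inner_test fun q hq => by
    simpa [h0] using Ω.inner_test_grad hq hG i
  exact Ω.eq_zero_of_inner_test fun q hq => by simpa [hG0] using (h q hq).symm

theorem mem_graph_dirichletLaplacian {p : Ω.L2 × Ω.L2} :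
    p ∈ Ω.dirichletLaplacian.graph ↔ p ∈ Ω.laplaceGraph := by
  rw [dirichletLaplacian, Submodule.toLinearPMap_graph_eq _ Ω.laplaceGraph_snd_eq_zero]

/-- A Friedrichs inequality on `H¹₀(Ω)`. -/
theorem friedrichs (i : Fin n) :
    ∃ C : ℝ, ∀ p ∈ Ω.sobolevH10, ‖p.1‖ ≤ C * ‖p.2 i‖ := by
  obtain ⟨R, hR⟩ := Ω.isBounded.exists_norm_le
  refine ⟨2 * R, fun p hp => ?_⟩
  have hcl : IsClosed {p : Ω.L2 × (Fin n → Ω.L2) | ‖p.1‖ ≤ 2 * R * ‖p.2 i‖} :=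
    isClosed_le (by fun_prop) (by fun_prop)
  refine closure_minimal (s := (Ω.testGraph : Set (Ω.L2 × (Fin n → Ω.L2)))) ?_ hcl hp
  rintro p hp
  have hp' := hp
  obtain ⟨φ, hφ, h1, h2⟩ := hp'
  have hsm : ContDiff ℝ ∞ fun x : EuclideanSpace ℝ (Fin n) => ((x i : ℝ) : ℂ) :=
    Complex.ofRealCLM.contDiff.comp (EuclideanSpace.proj (𝕜 := ℝ) i).contDiff
  have hmul : ∀ {ψ}, Ω.IsTest ψ → Ω.IsTest fun x => ((x i : ℝ) : ℂ) * ψ x := fun {ψ} h =>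
    ⟨hsm.mul h.1, h.2.1.mul_left, (tsupport_mul_subset_right).trans h.2.2⟩
  have hm := hmul hφ
  have hq := hmul (hφ.pderiv i)
  have hder : ∀ x, pderiv (fun x => ((x i : ℝ) : ℂ) * φ x) i x
      = φ x + ((x i : ℝ) : ℂ) * pderiv φ i x := fun x => by
    have e1 : HasFDerivAt (fun x : EuclideanSpace ℝ (Fin n) => ((x i : ℝ) : ℂ))
        (Complex.ofRealCLM.comp (EuclideanSpace.proj (𝕜 := ℝ) i)) x :=
      (Complex.ofRealCLM.comp (EuclideanSpace.proj (𝕜 := ℝ) i)).hasFDerivAt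
    have e2 := (hφ.1.differentiable (by simp) x).hasFDerivAt
    simp only [PlateDomain.pderiv]
    have e3 := (e1.mul e2).fderiv
    change fderiv ℝ ((fun x : EuclideanSpace ℝ (Fin n) => ((x i : ℝ) : ℂ)) * φ) x _ = _
    rw [e3]
    simp [add_comm]
  have ib := Ω.inner_test_grad hm.mem_testGraph (subset_closure hp) i
  simp only at ib
  have s1 : (hm.pderiv i).memLp.toLp _ = p.1 + hq.memLp.toLp _ := by
    apply Lp.ext
    filter_upwards [(hm.pderiv i).memLp.coeFn_toLp, Lp.coeFn_add p.1 (hq.memLp.toLp _),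
      hq.memLp.coeFn_toLp, h1] with x a b c d
    rw [a, b, Pi.add_apply, c, d, hder]
  rw [s1, inner_add_left] at ib
  have s2 : ⟪hq.memLp.toLp _, p.1⟫_ℂ = ⟪p.2 i, hm.memLp.toLp _⟫_ℂ := by
    rw [inner_eq_integral hq.memLp.coeFn_toLp h1 hq,
      inner_eq_integral (h2 i) hm.memLp.coeFn_toLp (hφ.pderiv i)]
    refine integral_congr_ae (.of_forall fun x => ?_)
    simp only [map_mul, Complex.conj_ofReal]; ring
  have hmn : ‖hm.memLp.toLp _‖ ≤ R * ‖p.1‖ := by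
    refine Lp.norm_le_mul_norm_of_ae_le_mul ?_
    filter_upwards [hm.memLp.coeFn_toLp, h1, ae_restrict_mem Ω.isOpen.measurableSet]
      with x a b hx
    rw [a, b, norm_mul]
    gcongr
    simpa using (PiLp.norm_apply_le x i).trans (hR x hx)
  have s3 : ⟪p.1, p.1⟫_ℂ = -⟪hm.memLp.toLp _, p.2 i⟫_ℂ - ⟪p.2 i, hm.memLp.toLp _⟫_ℂ := by
    rw [ib, ← s2]; ring
  have s4 : ‖p.1‖ ^ 2 ≤ 2 * (R * ‖p.1‖) * ‖p.2 i‖ := by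
    have e : ‖⟪p.1, p.1⟫_ℂ‖ = ‖p.1‖ ^ 2 := by
      rw [inner_self_eq_norm_sq_to_K]; simp
    rw [← e, s3]
    refine (norm_sub_le _ _).trans ?_
    rw [norm_neg]
    have b1 := norm_inner_le_norm (𝕜 := ℂ) (hm.memLp.toLp _ : Ω.L2) (p.2 i)
    have b2 := norm_inner_le_norm (𝕜 := ℂ) (p.2 i) (hm.memLp.toLp _ : Ω.L2)
    have b3 := mul_le_mul_of_nonneg_right hmn (norm_nonneg (p.2 i))
    linarith [mul_comm ‖p.2 i‖ ‖(hm.memLp.toLp _ : Ω.L2)‖]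
  change ‖p.1‖ ≤ 2 * R * ‖p.2 i‖
  rcases (norm_nonneg p.1).eq_or_lt with h | h
  · rw [← h]
    obtain ⟨x, hx⟩ := Ω.nonempty
    have := (norm_nonneg x).trans (hR x hx)
    positivity
  · nlinarith

theorem dirichletLaplacian_injective [NeZero n] :
    Function.Injective Ω.dirichletLaplacian := by
  suffices ∀ u, Ω.dirichletLaplacian u = 0 → u = 0 from
    (injective_iff_map_eq_zero Ω.dirichletLaplacian.toFun).2 this
  intro u hu
  have hmem := Ω.mem_graph_dirichletLaplacian.1 (Ω.dirichletLaplacian.mem_graph u)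
  rw [hu] at hmem
  obtain ⟨G, hG, h⟩ := hmem
  have hcl : IsClosed {q : Ω.L2 × (Fin n → Ω.L2) | ∑ i, ⟪q.2 i, G i⟫_ℂ = 0} :=
    isClosed_eq (by fun_prop) continuous_const
  have h0 : ∑ i, ⟪G i, G i⟫_ℂ = 0 :=
    closure_minimal (s := (Ω.testGraph : Set (Ω.L2 × (Fin n → Ω.L2)))) (fun q hq => by simpa using h q hq) hcl hG
  have h1 : ∑ i, ‖G i‖ ^ 2 = 0 := by
    have := congrArg Complex.re h0
    simpa [inner_self_eq_norm_sq_to_K, ← Complex.ofReal_pow] using this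
  have h2 : ‖G 0‖ = 0 := by
    have := (Finset.sum_eq_zero_iff_of_nonneg fun i _ => sq_nonneg ‖G i‖).1 h1 0
      (Finset.mem_univ _)
    exact pow_eq_zero_iff (two_ne_zero) |>.1 this
  obtain ⟨C, hC⟩ := Ω.friedrichs 0
  have := hC _ hG
  simp only [h2, mul_zero] at this
  exact Subtype.ext (norm_le_zero_iff.1 this)

instance [NeZero n] : Fact (Function.Injective Ω.dirichletLaplacian) :=
  ⟨Ω.dirichletLaplacian_injective⟩

end PlateDomain

/-! ### The thermoelastic plate -/

/-- The positive coefficients of the plate system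
`u_tt + γ A^τ u_tt + A² u - α A θ = 0`, `θ_t + κ A θ + β A u_t = 0`. -/
structure PlateCoefficients where
  α : ℝ
  β : ℝ
  γ : ℝ
  κ : ℝ
  α_pos : 0 < α
  β_pos : 0 < β
  γ_pos : 0 < γ
  κ_pos : 0 < κ

section Plate

variable {H : Type*} [NormedAddCommGroup H] [InnerProductSpace ℂ H] [CompleteSpace H]

/-- The phase space `D(A) × D(A^{τ/2}) × H` of states `(u, v, θ)`. -/
@[ext]
structure PlateState (A : H →ₗ.[ℂ] H) (c : PlateCoefficients) (τ : ℝ) where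
  u : A.domain
  v : (A.realPow (τ / 2)).domain
  θ : H

namespace PlateState

variable {A : H →ₗ.[ℂ] H} {c : PlateCoefficients} {τ : ℝ}

/-- The identification with triples, used to transport the linear structure. -/
noncomputable def equivProd : PlateState A c τ ≃ A.domain × (A.realPow (τ / 2)).domain × H where
  toFun U := (U.u, U.v, U.θ)
  invFun p := ⟨p.1, p.2.1, p.2.2⟩
  left_inv _ := rfl
  right_inv _ := rfl

noncomputable instance : AddCommGroup (PlateState A c τ) := equivProd.addCommGroup
noncomputable instance : Module ℂ (PlateState A c τ) := equivProd.module ℂ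

@[simp] theorem u_add (U V : PlateState A c τ) : (U + V).u = U.u + V.u := rfl
@[simp] theorem v_add (U V : PlateState A c τ) : (U + V).v = U.v + V.v := rfl
@[simp] theorem θ_add (U V : PlateState A c τ) : (U + V).θ = U.θ + V.θ := rfl
@[simp] theorem u_zero : (0 : PlateState A c τ).u = 0 := rfl
@[simp] theorem v_zero : (0 : PlateState A c τ).v = 0 := rfl
@[simp] theorem θ_zero : (0 : PlateState A c τ).θ = 0 := rfl
@[simp] theorem u_smul (a : ℂ) (U : PlateState A c τ) : (a • U).u = a • U.u := rfl
@[simp] theorem v_smul (a : ℂ) (U : PlateState A c τ) : (a • U).v = a • U.v := rfl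
@[simp] theorem θ_smul (a : ℂ) (U : PlateState A c τ) : (a • U).θ = a • U.θ := rfl

/-- The energy inner product
`β⟨Au₁, Au₂⟩ + β(⟨v₁, v₂⟩ + γ⟨A^{τ/2}v₁, A^{τ/2}v₂⟩) + α⟨θ₁, θ₂⟩`. -/
noncomputable def energyInner (U V : PlateState A c τ) : ℂ :=
  c.β * ⟪A U.u, A V.u⟫_ℂ
    + c.β * (⟪(U.v : H), (V.v : H)⟫_ℂ
        + c.γ * ⟪A.realPow (τ / 2) U.v, A.realPow (τ / 2) V.v⟫_ℂ)
    + c.α * ⟪U.θ, V.θ⟫_ℂ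

theorem energyInner_self (U : PlateState A c τ) :
    energyInner U U = ((c.β * ‖A U.u‖ ^ 2 + c.β * (‖(U.v : H)‖ ^ 2
      + c.γ * ‖A.realPow (τ / 2) U.v‖ ^ 2) + c.α * ‖U.θ‖ ^ 2 : ℝ) : ℂ) := by
  simp [energyInner, inner_self_eq_norm_sq_to_K]

variable [hA : Fact (Function.Injective A)]

/-- The phase space is an inner product space for the energy inner product. -/
noncomputable abbrev core : InnerProductSpace.Core ℂ (PlateState A c τ) where
  inner := energyInner
  conj_inner_symm U V := by simp [energyInner, inner_conj_symm]
  re_inner_nonneg U := by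
    have := c.α_pos.le
    have := c.β_pos.le
    have := c.γ_pos.le
    rw [energyInner_self, RCLike.re_eq_complex_re, Complex.ofReal_re]
    positivity
  add_left U V W := by
    simp only [energyInner, u_add, v_add, θ_add, LinearPMap.map_add, Submodule.coe_add,
      inner_add_left]
    ring
  smul_left U V a := by
    simp only [energyInner, u_smul, v_smul, θ_smul, LinearPMap.map_smul, Submodule.coe_smul,
      inner_smul_left]
    ring
  definite U h := by
    have hα := c.α_pos
    have hβ := c.β_pos
    have hγ := c.γ_pos
    rw [energyInner_self, Complex.ofReal_eq_zero] at h
    have a1 : 0 ≤ c.β * ‖A U.u‖ ^ 2 := by positivity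
    have a2 : 0 ≤ c.β * ‖(U.v : H)‖ ^ 2 := by positivity
    have a3 : 0 ≤ c.β * (c.γ * ‖A.realPow (τ / 2) U.v‖ ^ 2) := by positivity
    have a4 : 0 ≤ c.α * ‖U.θ‖ ^ 2 := by positivity
    have b1 : c.β * ‖A U.u‖ ^ 2 = 0 := by linarith
    have b2 : c.β * ‖(U.v : H)‖ ^ 2 = 0 := by linarith
    have b4 : c.α * ‖U.θ‖ ^ 2 = 0 := by linarith
    simp only [mul_eq_zero, hα.ne', hβ.ne', false_or, pow_eq_zero_iff two_ne_zero,
      norm_eq_zero] at b1 b2 b4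
    refine PlateState.ext (hA.out ?_) (Subtype.ext b2) b4
    rw [b1, u_zero, LinearPMap.map_zero]

noncomputable instance : NormedAddCommGroup (PlateState A c τ) :=
  (core (A := A) (c := c) (τ := τ)).toNormedAddCommGroup

noncomputable instance : InnerProductSpace ℂ (PlateState A c τ) :=
  InnerProductSpace.ofCore (core (A := A) (c := c) (τ := τ)).toCore

end PlateState

variable (A : H →ₗ.[ℂ] H) (c : PlateCoefficients) (τ : ℝ)

/-- The graph of the plate operator
`𝔹(u, v, θ) = (v, (I + γA^τ)⁻¹(-A²u + αAθ), -κAθ - βAv)` on the domain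
`{v ∈ D(A), -Au + αθ ∈ D(A^{1-τ/2}), -κθ - βv ∈ D(A)}`. A pair `(U, F)` belongs to it if
`v = F.u ∈ D(A)`; `w = A^{1-τ/2}(-Au + αθ)` exists and `(I + γA^τ) F.v = A(-Au + αθ)` in
`D(A^{-τ/2})`, the dual of `D(A^{τ/2})`, that is
`⟨z, F.v⟩ + γ⟨A^{τ/2}z, A^{τ/2}F.v⟩ = ⟨A^{τ/2}z, w⟩` for all `z ∈ D(A^{τ/2})`;
and `-κθ - βv ∈ D(A)` with `A(-κθ - βv) = F.θ`. -/
noncomputable def plateGraph : Submodule ℂ (PlateState A c τ × PlateState A c τ) where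
  carrier := {p |
    (p.1.v : H) = p.2.u ∧
    (∃ w : H, (-A p.1.u + (c.α : ℂ) • p.1.θ, w) ∈ (A.realPow (1 - τ / 2)).graph ∧
      ∀ z : (A.realPow (τ / 2)).domain,
        ⟪(z : H), (p.2.v : H)⟫_ℂ + c.γ * ⟪A.realPow (τ / 2) z, A.realPow (τ / 2) p.2.v⟫_ℂ
          = ⟪A.realPow (τ / 2) z, w⟫_ℂ) ∧
    (-(c.κ : ℂ) • p.1.θ - (c.β : ℂ) • (p.1.v : H), p.2.θ) ∈ A.graph}
  add_mem' := by
    rintro p q ⟨h1, ⟨w, hw, h2⟩, h3⟩ ⟨k1, ⟨y, hy, k2⟩, k3⟩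
    refine ⟨by simp [h1, k1], ⟨w + y, ?_, fun z => ?_⟩, ?_⟩
    · convert (A.realPow (1 - τ / 2)).graph.add_mem hw hy using 1
      simp only [Prod.fst_add, PlateState.u_add, PlateState.θ_add, LinearPMap.map_add,
        Prod.mk_add_mk, Prod.mk.injEq, and_true]
      module
    · rw [inner_add_right, ← h2 z, ← k2 z]
      simp only [Prod.snd_add, PlateState.v_add, LinearPMap.map_add, Submodule.coe_add,
        inner_add_right]
      ring
    · convert A.graph.add_mem h3 k3 using 1
      simp only [Prod.fst_add, Prod.snd_add, PlateState.v_add, PlateState.θ_add,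
        Submodule.coe_add, Prod.mk_add_mk, Prod.mk.injEq, and_true]
      module
  zero_mem' := by
    refine ⟨by simp, ⟨0, ?_, fun z => ?_⟩, ?_⟩
    · simp
    · simp
    · simp
  smul_mem' := by
    rintro a p ⟨h1, ⟨w, hw, h2⟩, h3⟩
    refine ⟨by simp [h1], ⟨a • w, ?_, fun z => ?_⟩, ?_⟩
    · convert (A.realPow (1 - τ / 2)).graph.smul_mem a hw using 1
      simp only [Prod.smul_fst, PlateState.u_smul, PlateState.θ_smul, LinearPMap.map_smul,
        Prod.smul_mk, Prod.mk.injEq, and_true]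
      module
    · rw [inner_smul_right, ← h2 z]
      simp only [Prod.smul_snd, PlateState.v_smul, LinearPMap.map_smul, Submodule.coe_smul,
        inner_smul_right]
      ring
    · convert A.graph.smul_mem a h3 using 1
      simp only [Prod.smul_fst, Prod.smul_snd, PlateState.v_smul, PlateState.θ_smul,
        Submodule.coe_smul, Prod.smul_mk, Prod.mk.injEq, and_true]
      module

/-- The plate operator `𝔹` on the phase space. -/
noncomputable def plateOperator : PlateState A c τ →ₗ.[ℂ] PlateState A c τ :=
  (plateGraph A c τ).toLinearPMap

/-- `𝔹` is single-valued, so that `plateOperator` indeed has the graph `plateGraph`. -/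
theorem mem_graph_plateOperator {p : PlateState A c τ × PlateState A c τ} :
    p ∈ (plateOperator A c τ).graph ↔ p ∈ plateGraph A c τ := by
  rw [plateOperator, Submodule.toLinearPMap_graph_eq]
  rintro ⟨U, F⟩ ⟨h1, ⟨w, hw, h2⟩, h3⟩ h0
  simp only at h0
  subst h0
  simp only at h1 h2 h3 hw ⊢
  have hw0 : w = 0 := by
    refine (A.realPow (1 - τ / 2)).graph_fst_eq_zero_snd hw ?_
    simp
  have hθ : F.θ = 0 := by
    refine A.graph_fst_eq_zero_snd h3 ?_
    simp
  have hv := h2 F.v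
  rw [hw0, inner_zero_right, inner_self_eq_norm_sq_to_K, inner_self_eq_norm_sq_to_K] at hv
  have hγ := c.γ_pos
  have hv' : ‖(F.v : H)‖ ^ 2 + c.γ * ‖A.realPow (τ / 2) F.v‖ ^ 2 = 0 := by
    have := congrArg Complex.re hv
    simpa [← Complex.ofReal_pow] using this
  have hv0 : ‖(F.v : H)‖ ^ 2 = 0 := by
    have : 0 ≤ c.γ * ‖A.realPow (τ / 2) F.v‖ ^ 2 := by positivity
    nlinarith [sq_nonneg ‖(F.v : H)‖]
  refine PlateState.ext (Subtype.ext ?_) (Subtype.ext ?_) hθ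
  · simpa using h1.symm
  · simpa using hv0

end Plate

/-! ### Diagonal contraction semigroups on a Hilbert sum -/

section DissipativeExp

variable {E : Type*} [NormedAddCommGroup E] [InnerProductSpace ℂ E] [CompleteSpace E]

/-! Separation of variables reduces the plate to a family of 3 × 3 systems. Rellich's theorem and a
Friedrichs inequality provide an orthonormal basis of eigenfunctions of `A`, with eigenvalues `λ`
bounded away from zero and unbounded above (`PlateDomain.exists_isDiagonal`). In the weighted
coordinates `(√β λ u, √β √(1 + γ λ^τ) v, √α θ)` the phase space is isometric to an `ℓ²` sum of
copies of `ℂ³` (`PlateState.coordEquiv`), and the plate operator, with exactly its prescribed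
domain, acts on each summand by `plateBlock` with `w = λ / √(1 + γ λ^τ)`, `k = √(αβ)` and `Λ = κ λ`
(`PlateState.mem_plateGraph_iff`).

Generation: a block is skew-adjoint apart from the damping `-Λ` of the temperature. The exponentials
of the blocks are therefore contractions, and they assemble into a contraction semigroup whose
generator has the maximal domain (`exists_semigroup_of_dissipative`).

Failure of analyticity: the characteristic polynomial of a block is `μ³ + Λ μ² + w² (1 + k²) μ + Λ
w²`. Since `τ > 0`, the inertia term makes `w / Λ` tend to zero along large eigenvalues, so the heat
component relaxes too fast to damp the oscillation effectively. There is a root with `Im μ ≥ w / 2`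
and `|Re μ| ≤ k² w² / Λ` (`exists_cubic_root`). Since `τ ≤ 1`, also `w → ∞`. Thus eigenvalues of the
generator go to infinity with `Re μ / Im μ → 0`.

This is incompatible with analyticity (`not_isAnalytic_of_eigenvalues`). By the identity theorem a
holomorphic extension acts on an eigenvector as multiplication by `exp (μ z)`. Along `z = e^{-iψ} /
√(Im μ)`, which tends to the vertex inside the sector, `Re (μ z)` behaves like `√(Im μ) sin ψ` and
is unbounded, whereas strong convergence at the vertex and the uniform boundedness principle keep `T
z` bounded there. -/

theorem hasDerivAt_exp_ofReal_smul_apply (M : E →L[ℂ] E) (x : E) (t : ℝ) :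
    HasDerivAt (fun s : ℝ => NormedSpace.exp ((s : ℂ) • M) x)
      (M (NormedSpace.exp ((t : ℂ) • M) x)) t := by
  have h := (ContinuousLinearMap.apply ℂ E x).hasFDerivAt.comp_hasDerivAt (t : ℂ)
    (hasDerivAt_exp_smul_const' (𝕂 := ℂ) M (t : ℂ))
  have h2 := h.scomp t Complex.ofRealCLM.hasDerivAt
  rw [Complex.ofRealCLM_apply, Complex.ofReal_one, one_smul] at h2
  exact h2

theorem exp_ofReal_smul_apply_comm (M : E →L[ℂ] E) (x : E) (t : ℝ) :
    M (NormedSpace.exp ((t : ℂ) • M) x) = NormedSpace.exp ((t : ℂ) • M) (M x) := by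
  have h : Commute M (NormedSpace.exp ((t : ℂ) • M)) :=
    ((Commute.refl M).smul_right _).exp_right
  exact DFunLike.congr_fun h.eq x

theorem exp_ofReal_smul_add (M : E →L[ℂ] E) (s t : ℝ) :
    NormedSpace.exp (((s + t : ℝ) : ℂ) • M)
      = NormedSpace.exp ((s : ℂ) • M) * NormedSpace.exp ((t : ℂ) • M) := by
  let : NormedAlgebra ℚ (E →L[ℂ] E) := NormedAlgebra.restrictScalars ℚ ℂ _
  rw [Complex.ofReal_add, add_smul]
  exact NormedSpace.exp_add_of_commute (((Commute.refl M).smul_right _).smul_left _)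

/-- The exponential of a dissipative bounded operator is a contraction. -/
theorem norm_exp_ofReal_smul_apply_le {M : E →L[ℂ] E} (hM : ∀ x, (⟪x, M x⟫_ℂ).re ≤ 0)
    {t : ℝ} (ht : 0 ≤ t) (x : E) : ‖NormedSpace.exp ((t : ℂ) • M) x‖ ≤ ‖x‖ := by
  let : InnerProductSpace ℝ E := InnerProductSpace.rclikeToReal ℂ E
  have hd : ∀ s : ℝ, HasDerivAt (fun s : ℝ => ‖NormedSpace.exp ((s : ℂ) • M) x‖ ^ 2)
      (2 * ⟪NormedSpace.exp ((s : ℂ) • M) x, M (NormedSpace.exp ((s : ℂ) • M) x)⟫_ℝ) s :=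
    fun s => (hasDerivAt_exp_ofReal_smul_apply M x s).norm_sq
  have hanti : Antitone fun s : ℝ => ‖NormedSpace.exp ((s : ℂ) • M) x‖ ^ 2 := by
    refine antitone_of_deriv_nonpos (fun s => (hd s).differentiableAt) fun s => ?_
    rw [(hd s).deriv]
    have := hM (NormedSpace.exp ((s : ℂ) • M) x)
    rw [real_inner_eq_re_inner ℂ]
    simp only [RCLike.re_eq_complex_re]
    linarith
  have h := hanti ht
  simp only [Complex.ofReal_zero, zero_smul, NormedSpace.exp_zero,
    one_apply_eq_self] at h
  exact (pow_le_pow_iff_left₀ (norm_nonneg _) (norm_nonneg _) two_ne_zero).1 h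

/-- The derivative of the orbit is `exp (s M) (M x)`, of norm at most `‖M x‖` by contractivity. The
resulting bound on difference quotients does not involve `‖M‖`, so it serves as a dominating
function for an unbounded family of blocks. -/
theorem norm_exp_ofReal_smul_apply_sub_le {M : E →L[ℂ] E} (hM : ∀ x, (⟪x, M x⟫_ℂ).re ≤ 0)
    {t : ℝ} (ht : 0 ≤ t) (x : E) :
    ‖NormedSpace.exp ((t : ℂ) • M) x - x‖ ≤ ‖M x‖ * t := by
  have h := norm_image_sub_le_of_norm_deriv_le_segment' (a := 0) (b := t)
    (f := fun s : ℝ => NormedSpace.exp ((s : ℂ) • M) x) (C := ‖M x‖)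
    (fun s _ => (hasDerivAt_exp_ofReal_smul_apply M x s).hasDerivWithinAt)
    (fun s hs => by
      rw [exp_ofReal_smul_apply_comm]
      exact norm_exp_ofReal_smul_apply_le hM hs.1 _) t (right_mem_Icc.2 ht)
  simpa using h

end DissipativeExp

/-! ### Square-summable families and diagonal semigroups -/

section HilbertSum

variable {ι : Type*} {E : Type*} [NormedAddCommGroup E]

theorem lp_two_norm_sq (f : lp (fun _ : ι => E) 2) : ‖f‖ ^ 2 = ∑' i, ‖f i‖ ^ 2 := by
  have := lp.norm_rpow_eq_tsum (p := 2) (by norm_num) f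
  simpa using this

theorem lp_two_summable (f : lp (fun _ : ι => E) 2) : Summable fun i => ‖f i‖ ^ 2 := by
  have := (lp.memℓp f).summable (p := 2) (by norm_num)
  simpa using this

theorem memℓp_two_of_summable {f : ι → E} (h : Summable fun i => ‖f i‖ ^ 2) :
    Memℓp (E := fun _ : ι => E) f 2 :=
  memℓp_gen (by simpa using h)

/-- Dominated convergence in a Hilbert sum. -/
theorem lp_two_tendsto_zero {α : Type*} {l : Filter α} {F : α → lp (fun _ : ι => E) 2}
    (g : lp (fun _ : ι => E) 2) (K : ℝ) (hb : ∀ᶠ a in l, ∀ i, ‖F a i‖ ≤ K * ‖g i‖)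
    (ht : ∀ i, Tendsto (fun a => F a i) l (𝓝 0)) : Tendsto F l (𝓝 0) := by
  have h : Tendsto (fun a => ∑' i, ‖F a i‖ ^ 2) l (𝓝 (∑' _ : ι, 0)) := by
    refine tendsto_tsum_of_dominated_convergence (bound := fun i => K ^ 2 * ‖g i‖ ^ 2)
      ((lp_two_summable g).mul_left _) (fun i => ?_) ?_
    · simpa using ((ht i).norm.pow 2)
    · filter_upwards [hb] with a ha i
      rw [Real.norm_of_nonneg (by positivity), ← mul_pow]
      exact pow_le_pow_left₀ (norm_nonneg _) (ha i) 2
  simp only [← lp_two_norm_sq, tsum_zero] at h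
  rw [tendsto_zero_iff_norm_tendsto_zero]
  have h2 := h.sqrt
  simpa using h2

theorem tendsto_lp_apply {α : Type*} {l : Filter α} {F : α → lp (fun _ : ι => E) 2}
    {g : lp (fun _ : ι => E) 2} (h : Tendsto F l (𝓝 g)) (i : ι) :
    Tendsto (fun a => F a i) l (𝓝 (g i)) := by
  rw [tendsto_iff_norm_sub_tendsto_zero] at h ⊢
  refine squeeze_zero (fun _ => norm_nonneg _) (fun a => ?_) h
  exact lp.norm_apply_le_norm (by norm_num) (F a - g) i

variable [InnerProductSpace ℂ E]

/-- The diagonal operator with contractive diagonal entries. -/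
noncomputable def lpDiag (L : ι → E →L[ℂ] E) (hL : ∀ i x, ‖L i x‖ ≤ ‖x‖) :
    lp (fun _ : ι => E) 2 →L[ℂ] lp (fun _ : ι => E) 2 :=
  LinearMap.mkContinuous
    { toFun := fun f => ⟨fun i => L i (f i), memℓp_two_of_summable <|
        (lp_two_summable f).of_nonneg_of_le (fun i => by positivity)
          fun i => pow_le_pow_left₀ (norm_nonneg _) (hL i _) 2⟩
      map_add' := fun f g => by ext i; exact map_add (L i) (f i) (g i)
      map_smul' := fun a f => by ext i; exact map_smul (L i) a (f i) } 1 fun f => by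
    rw [one_mul]
    refine lp.norm_mono (by norm_num) fun i => hL i (f i)

@[simp] theorem lpDiag_apply (L : ι → E →L[ℂ] E) (hL : ∀ i x, ‖L i x‖ ≤ ‖x‖)
    (f : lp (fun _ : ι => E) 2) (i : ι) : lpDiag L hL f i = L i (f i) := rfl

variable [CompleteSpace E] {X : Type*} [NormedAddCommGroup X] [NormedSpace ℂ X]

/-- On a space isometric to a Hilbert sum, a family of dissipative bounded operators on the
summands generates a contraction semigroup. -/
theorem exists_semigroup_of_dissipative (Φ : X ≃ₗᵢ[ℂ] lp (fun _ : ι => E) 2)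
    (M : ι → E →L[ℂ] E) (hM : ∀ i x, (⟪x, M i x⟫_ℂ).re ≤ 0) :
    ∃ S : StronglyContinuousSemigroup X, ∀ x y : X,
      Tendsto (fun t : NNReal => ((t : ℂ))⁻¹ • (S.op t x - x)) (𝓝[>] 0) (𝓝 y) ↔
        ∀ i, Φ y i = M i (Φ x i) := by
  have hc : ∀ (t : NNReal) (i : ι) (x : E),
      ‖NormedSpace.exp (((t : ℝ) : ℂ) • M i) x‖ ≤ ‖x‖ :=
    fun t i x => norm_exp_ofReal_smul_apply_le (hM i) t.coe_nonneg x
  let D : NNReal → lp (fun _ : ι => E) 2 →L[ℂ] lp (fun _ : ι => E) 2 :=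
    fun t => lpDiag (fun i => NormedSpace.exp (((t : ℝ) : ℂ) • M i)) (hc t)
  let S : StronglyContinuousSemigroup X :=
    { op := fun t => (Φ.symm : lp (fun _ : ι => E) 2 →L[ℂ] X).comp
        ((D t).comp (Φ : X →L[ℂ] lp (fun _ : ι => E) 2))
      map_zero := by
        ext x
        apply Φ.injective
        ext i
        simp [D]
      map_add := fun s t => by
        ext x
        apply Φ.injective
        ext i
        simp only [ContinuousLinearMap.comp_apply, LinearIsometryEquiv.coe_coe'',
          LinearIsometryEquiv.apply_symm_apply, D, lpDiag_apply]
        rw [NNReal.coe_add, exp_ofReal_smul_add]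
        rfl
      continuous_orbit := fun x => by
        refine Φ.symm.continuous.comp ?_
        rw [continuous_iff_continuousAt]
        intro t₀
        have h0 : Tendsto (fun t => D t (Φ x) - D t₀ (Φ x)) (𝓝 t₀) (𝓝 0) := by
          -- Both orbits are contractions applied to the same coordinate, hence the constant 2.
          refine lp_two_tendsto_zero (Φ x) 2 (.of_forall fun t i => ?_) fun i => ?_
          · have h1 := hc t i (Φ x i)
            have h2 := hc t₀ i (Φ x i)
            refine (norm_sub_le _ _).trans ?_
            simp only [D, lpDiag_apply]
            linarith
          · have hcont : Continuous fun t : NNReal =>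
                NormedSpace.exp (((t : ℝ) : ℂ) • M i) (Φ x i) :=
              (continuous_iff_continuousAt.2 fun s : ℝ =>
                (hasDerivAt_exp_ofReal_smul_apply (M i) (Φ x i) s).continuousAt).comp
                NNReal.continuous_coe
            have := (hcont.tendsto t₀).sub_const
              (NormedSpace.exp (((t₀ : ℝ) : ℂ) • M i) (Φ x i))
            simpa [D] using this
        exact tendsto_sub_nhds_zero_iff.1 h0 }
  refine ⟨S, fun x y => ?_⟩
  have hΦ : ∀ t : NNReal, ∀ i, Φ (((t : ℂ))⁻¹ • (S.op t x - x)) i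
      = ((t : ℂ))⁻¹ • (NormedSpace.exp (((t : ℝ) : ℂ) • M i) (Φ x i) - Φ x i) := fun t i => by
    rw [map_smul, map_sub, lp.coeFn_smul, Pi.smul_apply, lp.coeFn_sub, Pi.sub_apply]
    simp only [S, D, ContinuousLinearMap.comp_apply, LinearIsometryEquiv.coe_coe'',
      LinearIsometryEquiv.apply_symm_apply, lpDiag_apply]
  have hder : ∀ i, Tendsto (fun t : NNReal => ((t : ℂ))⁻¹ •
      (NormedSpace.exp (((t : ℝ) : ℂ) • M i) (Φ x i) - Φ x i)) (𝓝[>] 0)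
      (𝓝 (M i (Φ x i))) := fun i => by
    have h := (hasDerivAt_exp_ofReal_smul_apply (M i) (Φ x i) 0).tendsto_slope_zero_right
    have hcoe : Tendsto (fun t : NNReal => (t : ℝ)) (𝓝[>] 0) (𝓝[>] 0) := by
      refine tendsto_nhdsWithin_iff.2 ⟨?_, ?_⟩
      · exact (NNReal.continuous_coe.tendsto 0).mono_left nhdsWithin_le_nhds
      · filter_upwards [self_mem_nhdsWithin] with t ht
        exact NNReal.coe_pos.2 ht
    have h2 := h.comp hcoe
    simp only [Complex.ofReal_zero, zero_smul, NormedSpace.exp_zero,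
      one_apply_eq_self, zero_add] at h2
    refine h2.congr fun t => ?_
    simp only [Function.comp_apply]
    rw [← Complex.coe_smul, Complex.ofReal_inv]
  constructor
  · intro h i
    have h1 := tendsto_lp_apply ((Φ.continuous.tendsto y).comp h) i
    refine tendsto_nhds_unique h1 ?_
    exact (hder i).congr fun t => (hΦ t i).symm
  · intro h
    have key : Tendsto (fun t : NNReal => Φ (((t : ℂ))⁻¹ • (S.op t x - x)) - Φ y) (𝓝[>] 0)
        (𝓝 0) := by
      -- Each coordinate of the difference quotient is bounded by `‖M i (Φ x i)‖ = ‖Φ y i‖`.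
      -- Square-summability of the candidate value `y` is thus all that membership in the domain
      -- requires.
      refine lp_two_tendsto_zero (Φ y) 2 ?_ fun i => ?_
      · filter_upwards [self_mem_nhdsWithin] with t ht i
        have ht' : (0 : ℝ) < t := ht
        rw [lp.coeFn_sub, Pi.sub_apply, hΦ]
        have h1 : ‖((t : ℂ))⁻¹ •
            (NormedSpace.exp (((t : ℝ) : ℂ) • M i) (Φ x i) - Φ x i)‖ ≤ ‖Φ y i‖ := by
          have := norm_exp_ofReal_smul_apply_sub_le (hM i) t.coe_nonneg (Φ x i)
          rw [← h i] at this
          rw [norm_smul, norm_inv]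
          have e : ‖((t : NNReal) : ℂ)‖ = t := by
            simp
          rw [e, inv_mul_le_iff₀ ht']
          linarith
        refine (norm_sub_le _ _).trans ?_
        linarith
      · have := (hder i).sub_const (M i (Φ x i))
        rw [sub_self] at this
        refine this.congr fun t => ?_
        rw [lp.coeFn_sub, Pi.sub_apply, hΦ, h i]
    have h2 := (Φ.symm.continuous.tendsto _).comp (tendsto_sub_nhds_zero_iff.1 key)
    simpa [Function.comp_def] using h2

end HilbertSum

/-! ### Eigenvalues of the generator of an analytic semigroup -/

namespace StronglyContinuousSemigroup

variable {X : Type*} [NormedAddCommGroup X] [NormedSpace ℂ X]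

/-- If the generator has the eigenvalue `μ` at `w`, then `S(t) w = e ^ (μ t) w`. -/
theorem op_eigenvector {S : StronglyContinuousSemigroup X} {B : X →ₗ.[ℂ] X}
    (hS : S.IsGeneratedBy B) {μ : ℂ} {w : X} (hw : (w, μ • w) ∈ B.graph) (t : NNReal) :
    S.op t w = Complex.exp (μ * ((t : ℝ) : ℂ)) • w := by
  have h0 := (hS w (μ • w)).1 hw
  have hcont : Continuous fun s : ℝ => S.op s.toNNReal w :=
    (S.continuous_orbit w).comp continuous_real_toNNReal
  have hslope : ∀ s : ℝ, 0 ≤ s →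
      HasDerivWithinAt (fun s : ℝ => S.op s.toNNReal w) (μ • S.op s.toNNReal w) (Ici s) s := by
    intro s hs
    rw [← hasDerivWithinAt_Ioi_iff_Ici, hasDerivWithinAt_iff_tendsto_slope' self_notMem_Ioi]
    have h1 := ((S.op s.toNNReal).continuous.tendsto _).comp h0
    rw [map_smul] at h1
    have hcoe : Tendsto (fun r : ℝ => (r - s).toNNReal) (𝓝[>] s) (𝓝[>] 0) := by
      refine tendsto_nhdsWithin_iff.2 ⟨?_, ?_⟩
      · have hc : Continuous fun r : ℝ => (r - s).toNNReal := by fun_prop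
        have := hc.tendsto s
        rw [sub_self, Real.toNNReal_zero] at this
        exact this.mono_left nhdsWithin_le_nhds
      · filter_upwards [self_mem_nhdsWithin] with r hr
        exact Real.toNNReal_pos.2 (sub_pos.2 hr)
    refine (h1.comp hcoe).congr' ?_
    filter_upwards [self_mem_nhdsWithin] with r hr
    have hr' : 0 < r - s := sub_pos.2 hr
    have e : r.toNNReal = s.toNNReal + (r - s).toNNReal := by
      rw [← Real.toNNReal_add hs hr'.le]; congr 1; ring
    simp only [Function.comp_apply, slope, vsub_eq_sub]
    rw [map_smul, map_sub, e, S.map_add, ContinuousLinearMap.comp_apply,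
      ← Complex.coe_smul, Complex.ofReal_inv, Real.coe_toNNReal _ hr'.le]
  -- The definition of the generator yields right derivatives only. The product `e^{-μ s} S(s) w`
  -- has vanishing right derivative and is continuous, which already makes it constant.
  let f : ℝ → X := fun s => Complex.exp (-(μ * (s : ℂ))) • S.op s.toNNReal w
  have hexp : ∀ s : ℝ, HasDerivAt (fun s : ℝ => Complex.exp (-(μ * (s : ℂ))))
      (Complex.exp (-(μ * (s : ℂ))) * -(μ * 1)) s := fun s =>
    (((hasDerivAt_id (s : ℂ)).const_mul μ).neg.cexp).comp_ofReal
  have hf : ∀ s ∈ Icc (0 : ℝ) t, f s = f 0 := by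
    refine constant_of_has_deriv_right_zero ?_ fun s hs => ?_
    · exact (Continuous.smul (by fun_prop) hcont).continuousOn
    · have := (hexp s).hasDerivWithinAt.smul (hslope s hs.1)
      rw [smul_smul, ← add_smul, mul_one, mul_neg, add_neg_cancel, zero_smul] at this
      exact this
  have h1 := hf t ⟨t.coe_nonneg, le_rfl⟩
  simp only [f, Real.toNNReal_coe, Complex.ofReal_zero, mul_zero, neg_zero, Complex.exp_zero,
    one_smul, Real.toNNReal_zero, S.map_zero, ContinuousLinearMap.id_apply] at h1
  conv_rhs => rw [← h1]
  rw [smul_smul, ← Complex.exp_add, add_neg_cancel, Complex.exp_zero, one_smul]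

/-- In logarithmic coordinates the sector is the strip `|Im ζ| < φ`; as `φ ≤ π / 2`, the imaginary
part is the principal argument. The strip is convex, which gives the connectedness needed for the
identity theorem. -/
theorem exp_mem_sector {φ : ℝ} (hφ : φ ≤ Real.pi / 2) {ζ : ℂ} (hζ : |ζ.im| < φ) :
    Complex.exp ζ ∈ sector φ := by
  refine ⟨Complex.exp_ne_zero _, ?_⟩
  have h := abs_lt.1 hζ
  have := Real.pi_pos
  rw [Complex.arg_exp, (toIocMod_eq_self _).2]
  · exact hζ
  · constructor <;> linarith

/-- The holomorphic extension of a semigroup acts on the eigenvectors of the generator by the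
exponential. -/
theorem extension_eigenvector {S : StronglyContinuousSemigroup X} {B : X →ₗ.[ℂ] X}
    (hS : S.IsGeneratedBy B) {μ : ℂ} {w : X} (hw : (w, μ • w) ∈ B.graph) {φ : ℝ} (hφ0 : 0 < φ)
    (hφ : φ ≤ Real.pi / 2) {T : ℂ → X →L[ℂ] X} (hT : DifferentiableOn ℂ T (sector φ))
    (hTS : ∀ t : NNReal, 0 < t → T (t : ℂ) = S.op t) {ζ : ℂ} (hζ : |ζ.im| < φ) [CompleteSpace X] :
    T (Complex.exp ζ) w = Complex.exp (μ * Complex.exp ζ) • w := by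
  let U : Set ℂ := {ζ | |ζ.im| < φ}
  have hUo : IsOpen U := isOpen_lt (by fun_prop) continuous_const
  have hUc : Convex ℝ U := by
    have : U = Complex.imLm ⁻¹' (Ioo (-φ) φ) := by
      ext z; simp [U, abs_lt]
    rw [this]
    exact (convex_Ioo _ _).linear_preimage _
  have hmaps : MapsTo Complex.exp U (sector φ) := fun ζ hζ => exp_mem_sector hφ hζ
  have hf : DifferentiableOn ℂ (fun ζ => T (Complex.exp ζ) w) U :=
    (hT.comp Complex.differentiable_exp.differentiableOn hmaps).clm_apply
      (differentiableOn_const w)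
  have hg : DifferentiableOn ℂ (fun ζ => Complex.exp (μ * Complex.exp ζ) • w) U := by
    fun_prop
  -- Identity theorem on the strip: the two functions agree on the real axis, which corresponds to
  -- positive times and accumulates at `0`.
  refine (hf.analyticOnNhd hUo).eqOn_of_preconnected_of_frequently_eq (hg.analyticOnNhd hUo)
    hUc.isPreconnected (z₀ := 0) (by simpa [U] using hφ0) ?_ hζ
  have hreal : ∀ r : ℝ, T (Complex.exp r) w = Complex.exp (μ * Complex.exp r) • w := fun r => by
    have h := op_eigenvector hS hw (Real.exp r).toNNReal
    rw [← hTS _ (Real.toNNReal_pos.2 (Real.exp_pos r)),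
      Real.coe_toNNReal _ (Real.exp_pos r).le, Complex.ofReal_exp] at h
    exact h
  have ht : Tendsto (fun r : ℝ => (r : ℂ)) (𝓝[>] 0) (𝓝[≠] 0) := by
    refine tendsto_nhdsWithin_iff.2 ⟨?_, ?_⟩
    · exact (Complex.continuous_ofReal.tendsto' 0 0 rfl).mono_left nhdsWithin_le_nhds
    · filter_upwards [self_mem_nhdsWithin] with r hr
      simpa using (ne_of_gt hr)
  exact ht.frequently (Frequently.of_forall fun r => hreal r)

/-- The eigenvalues of the generator of an analytic semigroup cannot run to infinity tangentially
to the imaginary axis. -/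
theorem not_isAnalytic_of_eigenvalues [CompleteSpace X] {S : StronglyContinuousSemigroup X}
    {B : X →ₗ.[ℂ] X} (hS : S.IsGeneratedBy B) (μ : ℕ → ℂ) (w : ℕ → X) (hw0 : ∀ k, w k ≠ 0)
    (hw : ∀ k, (w k, μ k • w k) ∈ B.graph) (him : Tendsto (fun k => (μ k).im) atTop atTop)
    (hre : Tendsto (fun k => (μ k).re / (μ k).im) atTop (𝓝 0)) : ¬ S.IsAnalytic := by
  rintro ⟨φ, hφ0, hφ, T, hT, hTS, -, hT0⟩
  have hpi := Real.pi_pos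
  set ψ := φ / 2 with hψ
  have hsin : 0 < Real.sin ψ := Real.sin_pos_of_pos_of_lt_pi (by linarith) (by linarith)
  -- the points `e ^ (-iψ) / √(Im μ_k)` tend to the vertex of the sector
  let ζ : ℕ → ℂ := fun k => ⟨-(Real.log (μ k).im / 2), -ψ⟩
  have hζ : ∀ k, |(ζ k).im| < φ := fun k => by
    simp only [ζ, abs_neg, abs_of_pos (show 0 < ψ by linarith)]
    linarith
  have hlog : Tendsto (fun k => Real.log (μ k).im / 2) atTop atTop :=
    (Real.tendsto_log_atTop.comp him).atTop_div_const two_pos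
  have hz : Tendsto (fun k => Complex.exp (ζ k)) atTop (𝓝[sector φ] 0) := by
    refine tendsto_nhdsWithin_iff.2 ⟨?_, .of_forall fun k => exp_mem_sector hφ (hζ k)⟩
    rw [tendsto_zero_iff_norm_tendsto_zero]
    simp only [Complex.norm_exp, ζ]
    exact Real.tendsto_exp_neg_atTop_nhds_zero.comp hlog
  -- For each vector the images converge along the sequence, hence are bounded; Banach–Steinhaus
  -- makes the bound uniform.
  obtain ⟨C, hC⟩ : ∃ C, ∀ k, ‖T (Complex.exp (ζ k))‖ ≤ C := by
    refine banach_steinhaus fun x => ?_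
    obtain ⟨C, hC⟩ := (((hT0 x).comp hz).norm).bddAbove_range
    exact ⟨C, fun k => hC ⟨k, rfl⟩⟩
  have hbd : ∀ k, (μ k * Complex.exp (ζ k)).re ≤ Real.log C := fun k => by
    have h := extension_eigenvector hS (hw k) hφ0 hφ hT hTS (hζ k)
    have h2 := ((T (Complex.exp (ζ k))).le_opNorm (w k)).trans
      (mul_le_mul_of_nonneg_right (hC k) (norm_nonneg _))
    rw [h, norm_smul, Complex.norm_exp] at h2
    have h3 := le_of_mul_le_mul_right h2 (norm_pos_iff.2 (hw0 k))
    rwa [← Real.le_log_iff_exp_le ((Real.exp_pos _).trans_le h3)] at h3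
  -- but the real part of `μ_k z_k` is unbounded
  have hlim : Tendsto (fun k => (μ k).re / (μ k).im * Real.cos ψ + Real.sin ψ) atTop
      (𝓝 (Real.sin ψ)) := by
    simpa using (hre.mul_const (Real.cos ψ)).add_const (Real.sin ψ)
  have hprod : Tendsto (fun k => Real.exp (Real.log (μ k).im / 2) *
      ((μ k).re / (μ k).im * Real.cos ψ + Real.sin ψ)) atTop atTop :=
    (Real.tendsto_exp_atTop.comp hlog).atTop_mul_pos hsin hlim
  obtain ⟨k, hk1, hk2⟩ := ((hprod.eventually_gt_atTop (Real.log C)).and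
    (him.eventually_gt_atTop 0)).exists
  refine absurd (hbd k) (not_le.2 (hk1.trans_eq ?_))
  -- The modulus of the chosen point is `(Im μ)^{-1/2}`, so its product with `Im μ` still tends to
  -- infinity although the point tends to `0`.
  have e : Real.exp (-(Real.log (μ k).im / 2)) * (μ k).im = Real.exp (Real.log (μ k).im / 2) := by
    conv_lhs => rw [← Real.exp_log hk2, ← Real.exp_add, Real.exp_log hk2]
    congr 1; ring
  have e2 : Complex.exp (ζ k) = ⟨Real.exp (-(Real.log (μ k).im / 2)) * Real.cos ψ,
      -(Real.exp (-(Real.log (μ k).im / 2)) * Real.sin ψ)⟩ := by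
    apply Complex.ext <;> simp [Complex.exp_re, Complex.exp_im, ζ]
  rw [e2, Complex.mul_re, ← e]
  field_simp
  ring

end StronglyContinuousSemigroup

/-! ### The `3 × 3` blocks of the plate operator -/

/-- The block of the plate operator on one eigenfunction, in energy coordinates. -/
noncomputable def plateBlock (w k Λ : ℝ) : EuclideanSpace ℂ (Fin 3) →L[ℂ] EuclideanSpace ℂ (Fin 3) :=
  LinearMap.toContinuousLinearMap
    { toFun := fun x => !₂[(w : ℂ) * x 1, -(w : ℂ) * x 0 + k * w * x 2, -(Λ : ℂ) * x 2 - k * w * x 1]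
      map_add' := fun x y => by
        ext i; fin_cases i <;> simp <;> ring
      map_smul' := fun a x => by
        ext i; fin_cases i <;> simp <;> ring }

theorem plateBlock_apply (w k Λ : ℝ) (x : EuclideanSpace ℂ (Fin 3)) : plateBlock w k Λ x =
    !₂[(w : ℂ) * x 1, -(w : ℂ) * x 0 + k * w * x 2, -(Λ : ℂ) * x 2 - k * w * x 1] := rfl

/-- The entries `± w` and `± k w` form a skew-adjoint matrix and cancel in the real part; only the
thermal damping contributes. -/
theorem plateBlock_dissipative (w k : ℝ) {Λ : ℝ} (hΛ : 0 ≤ Λ) (x : EuclideanSpace ℂ (Fin 3)) :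
    (⟪x, plateBlock w k Λ x⟫_ℂ).re ≤ 0 := by
  have : (⟪x, plateBlock w k Λ x⟫_ℂ).re = -(Λ * ‖x 2‖ ^ 2) := by
    rw [plateBlock_apply, ← Complex.normSq_eq_norm_sq, Complex.normSq_apply]
    simp [PiLp.inner_apply, Fin.sum_univ_three]
    ring
  rw [this]
  have : 0 ≤ Λ * ‖x 2‖ ^ 2 := by positivity
  linarith

/-- The vector solves the first and third rows for every `μ`; the second row is then the
characteristic equation. -/
theorem plateBlock_eigenvector {w k Λ : ℝ} {μ : ℂ}
    (hμ : μ ^ 3 + Λ * μ ^ 2 + (w ^ 2 * (1 + k ^ 2) : ℝ) * μ + (Λ * w ^ 2 : ℝ) = 0) :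
    plateBlock w k Λ !₂[w * (μ + Λ), μ * (μ + Λ), -k * w * μ]
      = μ • !₂[w * (μ + Λ), μ * (μ + Λ), -k * w * μ] := by
  push_cast at hμ
  rw [plateBlock_apply]
  ext i
  fin_cases i
  · simp; ring
  · simp; linear_combination -hμ
  · simp; ring

/-! ### Asymptotics of the characteristic roots -/

/-- The characteristic polynomial of a block with `w ≪ Λ` has a root near `i w`. -/
theorem exists_cubic_root {w Λ κ : ℝ} (hw : 0 < w) (hΛ : 0 < Λ) (hκ : 0 < κ)
    (h : 2 * (κ * w) ≤ Λ) :
    ∃ μ : ℂ, μ ^ 3 + Λ * μ ^ 2 + (w ^ 2 * (1 + κ) : ℝ) * μ + (Λ * w ^ 2 : ℝ) = 0 ∧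
      w / 2 ≤ μ.im ∧ |μ.re| ≤ κ * w ^ 2 / Λ := by
  -- The polynomial is positive at `0` and negative at `-Λ`, so it has a real root `-r` between
  -- them. Dividing it out leaves `μ² + s μ + q` with `s = Λ - r`, and the task becomes to show that
  -- `s` is small.
  obtain ⟨r, ⟨hr0, hrΛ⟩, hr⟩ : ∃ r ∈ Icc 0 Λ,
      -r ^ 3 + Λ * r ^ 2 - w ^ 2 * (1 + κ) * r + Λ * w ^ 2 = 0 := by
    have hc : ContinuousOn (fun r : ℝ =>
      -r ^ 3 + Λ * r ^ 2 - w ^ 2 * (1 + κ) * r + Λ * w ^ 2) (Icc 0 Λ) := by fun_prop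
    refine intermediate_value_Icc' hΛ.le hc ⟨?_, ?_⟩
    · have : 0 < κ * w ^ 2 * Λ := by positivity
      nlinarith
    · have : 0 < Λ * w ^ 2 := by positivity
      simpa using this.le
  have hr0 : 0 < r := by
    rcases hr0.eq_or_lt with h0 | h0
    · rw [← h0] at hr
      have : 0 < Λ * w ^ 2 := by positivity
      simp at hr
      rcases hr with h | h <;> linarith
    · exact h0
  set s := Λ - r with hs
  set q := w ^ 2 * (1 + κ) - r * s with hq
  have hs0 : 0 ≤ s := by linarith
  have e1 : (r ^ 2 + w ^ 2) * s = κ * w ^ 2 * r := by rw [hs]; linear_combination hr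
  have e2 : r * q = Λ * w ^ 2 := by rw [hq, hs]; linear_combination -hr
  -- From `e1` together with `2 r w ≤ r² + w²`. Combined with the hypothesis `h`, it forces `r` to
  -- be comparable to `Λ`.
  have s1 : 2 * s ≤ κ * w := by
    have : (2 * s) * (w * r) ≤ κ * w * (w * r) := by nlinarith [sq_nonneg (r - w)]
    exact le_of_mul_le_mul_right this (by positivity)
  have r1 : Λ ≤ 2 * r := by nlinarith
  have s2 : r * s ≤ κ * w ^ 2 := by
    have : r * s * r ≤ κ * w ^ 2 * r := by nlinarith [mul_nonneg (sq_nonneg w) hs0]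
    exact le_of_mul_le_mul_right this hr0
  have s3 : s / 2 ≤ κ * w ^ 2 / Λ := by
    rw [le_div_iff₀ hΛ]
    nlinarith
  have s4 : s ≤ w := by
    have : s * Λ ≤ w * Λ := by nlinarith
    exact le_of_mul_le_mul_right this hΛ
  have q1 : w ^ 2 ≤ q := by
    have : w ^ 2 * r ≤ q * r := by nlinarith [sq_nonneg w]
    exact le_of_mul_le_mul_right this hr0
  -- With `q ≥ w²` and `s ≤ w` the right side is at least `3 w² / 4`. The quadratic factor therefore
  -- has the non-real roots `-s/2 ± i √(q - s²/4)`, of which the upper one is taken.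
  have hd : (w / 2) ^ 2 ≤ q - s ^ 2 / 4 := by nlinarith
  refine ⟨⟨-(s / 2), √(q - s ^ 2 / 4)⟩, ?_, Real.le_sqrt_of_sq_le hd, ?_⟩
  · have hsq : (√(q - s ^ 2 / 4)) ^ 2 = q - s ^ 2 / 4 :=
      Real.sq_sqrt ((sq_nonneg _).trans hd)
    set y := √(q - s ^ 2 / 4)
    set μ : ℂ := ⟨-(s / 2), y⟩ with hμ
    have e3 : μ ^ 2 + s * μ + q = 0 := by
      apply Complex.ext
      · simp [hμ, pow_two]
        linear_combination -hsq
      · simp [hμ, pow_two]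
        ring
    have f1 : (Λ : ℂ) = r + s := by rw [hs]; push_cast; ring
    have f2 : ((w ^ 2 * (1 + κ) : ℝ) : ℂ) = q + r * s := by rw [hq]; push_cast; ring
    have f3 : ((Λ * w ^ 2 : ℝ) : ℂ) = r * q := by rw [← e2]; push_cast; ring
    rw [f1, f2, f3]
    linear_combination (μ + r) * e3
  · rw [abs_neg, abs_of_nonneg (by positivity)]
    exact s3

/-- The frequency `λ / √(1 + γ λ ^ τ)` tends to infinity with the eigenvalue `λ`. -/
theorem tendsto_div_sqrt_rpow_atTop {γ τ : ℝ} (hγ : 0 < γ) (hτ : τ ∈ Ioc (0 : ℝ) 1) :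
    Tendsto (fun x : ℝ => x / √(1 + γ * x ^ τ)) atTop atTop := by
  have h1 : Tendsto (fun x : ℝ => √x / √(1 + γ)) atTop atTop :=
    Real.tendsto_sqrt_atTop.atTop_div_const (by positivity)
  refine tendsto_atTop_mono' _ ?_ h1
  filter_upwards [eventually_ge_atTop 1] with x hx
  have hx0 : 0 < x := by linarith
  -- Here `τ ≤ 1` enters: the frequency grows at least like `√x`.
  have hp : x ^ τ ≤ x := by simpa using Real.rpow_le_rpow_of_exponent_le hx hτ.2
  have h2 : √(1 + γ * x ^ τ) ≤ √x * √(1 + γ) := by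
    rw [← Real.sqrt_mul hx0.le]
    exact Real.sqrt_le_sqrt (by nlinarith)
  have h3 : 0 < √(1 + γ * x ^ τ) := by positivity
  rw [div_le_div_iff₀ (by positivity) h3]
  calc √x * √(1 + γ * x ^ τ) ≤ √x * (√x * √(1 + γ)) := by gcongr
    _ = x * √(1 + γ) := by rw [← mul_assoc, Real.mul_self_sqrt hx0.le]

/-- This factor is the ratio of the frequency `w` to the eigenvalue. Its decay, which rests on `τ >
0`, separates the mechanical scale from the thermal one. -/
theorem tendsto_inv_sqrt_rpow_zero {γ τ : ℝ} (hγ : 0 < γ) (hτ : τ ∈ Ioc (0 : ℝ) 1) :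
    Tendsto (fun x : ℝ => (√(1 + γ * x ^ τ))⁻¹) atTop (𝓝 0) :=
  tendsto_inv_atTop_zero.comp <| Real.tendsto_sqrt_atTop.comp <|
    tendsto_atTop_add_const_left _ _ <| (tendsto_rpow_atTop hτ.1).const_mul_atTop hγ

/-- For a sequence of eigenvalues tending to infinity, the characteristic roots of the blocks
run to infinity tangentially to the imaginary axis. -/
theorem exists_characteristic_roots {γ τ κ k : ℝ} (hγ : 0 < γ) (hτ : τ ∈ Ioc (0 : ℝ) 1)
    (hκ : 0 < κ) (hk : 0 < k) {ev : ℕ → ℝ} (hev : Tendsto ev atTop atTop) :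
    ∃ (N : ℕ) (μ : ℕ → ℂ), (∀ j, μ j ^ 3 + (κ * ev (j + N) : ℝ) * μ j ^ 2
        + ((ev (j + N) / √(1 + γ * ev (j + N) ^ τ)) ^ 2 * (1 + k ^ 2) : ℝ) * μ j
        + (κ * ev (j + N) * (ev (j + N) / √(1 + γ * ev (j + N) ^ τ)) ^ 2 : ℝ) = 0) ∧
      (∀ j, 0 < ev (j + N)) ∧ (∀ j, 0 < (μ j).im) ∧
      Tendsto (fun j => (μ j).im) atTop atTop ∧
      Tendsto (fun j => (μ j).re / (μ j).im) atTop (𝓝 0) := by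
  have hsmall : ∀ᶠ x : ℝ in atTop, 0 < x ∧ 2 * (k ^ 2 * (x / √(1 + γ * x ^ τ))) ≤ κ * x := by
    have h0 := (tendsto_inv_sqrt_rpow_zero hγ hτ).const_mul (2 * k ^ 2)
    rw [mul_zero] at h0
    filter_upwards [h0.eventually_lt_const hκ, eventually_gt_atTop 0] with x h1 h2
    refine ⟨h2, ?_⟩
    calc 2 * (k ^ 2 * (x / √(1 + γ * x ^ τ))) = 2 * k ^ 2 * (√(1 + γ * x ^ τ))⁻¹ * x := by
          rw [div_eq_mul_inv]; ring
      _ ≤ κ * x := by gcongr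
  obtain ⟨N, hN⟩ := eventually_atTop.1 (hev.eventually hsmall)
  have hpos : ∀ j, 0 < ev (j + N) := fun j => (hN (j + N) (by omega)).1
  -- The parameter `κ` of the cubic is the squared coupling `k²`; the heat conductivity enters only
  -- through `Λ`.
  have hroot := fun j => exists_cubic_root (w := ev (j + N) / √(1 + γ * ev (j + N) ^ τ))
    (Λ := κ * ev (j + N)) (κ := k ^ 2) (by have := hpos j; positivity)
    (by have := hpos j; positivity) (by positivity) (hN (j + N) (by omega)).2
  choose μ h1 h2 h3 using hroot
  have hevN : Tendsto (fun j => ev (j + N)) atTop atTop := hev.comp (tendsto_add_atTop_nat N)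
  have hw : ∀ j, 0 < ev (j + N) / √(1 + γ * ev (j + N) ^ τ) := fun j => by
    have := hpos j; positivity
  have him : ∀ j, 0 < (μ j).im := fun j => lt_of_lt_of_le (half_pos (hw j)) (h2 j)
  refine ⟨N, μ, h1, hpos, him, tendsto_atTop_mono h2
    (((tendsto_div_sqrt_rpow_atTop hγ hτ).comp hevN).atTop_div_const two_pos), ?_⟩
  have h0 := ((tendsto_inv_sqrt_rpow_zero hγ hτ).comp hevN).const_mul (2 * k ^ 2 / κ)
  rw [mul_zero] at h0
  refine squeeze_zero_norm (fun j => ?_) h0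
  have hp := hpos j
  rw [Real.norm_eq_abs, abs_div, abs_of_pos (him j), div_le_iff₀ (him j)]
  -- Divide `k² w² / (κ λ)` by the lower bound `w / 2` of the imaginary part: what remains is `(2 k²
  -- / κ) (w / λ)`.
  calc |(μ j).re| ≤ _ := h3 j
    _ = 2 * k ^ 2 / κ * (√(1 + γ * ev (j + N) ^ τ))⁻¹ *
          (ev (j + N) / √(1 + γ * ev (j + N) ^ τ) / 2) := by
        field_simp
    _ ≤ _ := by
        simp only [Function.comp_apply]
        gcongr
        exact h2 j

/-! ### Operators that are diagonal in a Hilbert basis -/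

section Diagonal

variable {ι : Type*} {H : Type*} [NormedAddCommGroup H] [InnerProductSpace ℂ H]

namespace HilbertBasis

variable (b : HilbertBasis ι ℂ H)

theorem ext_repr {x y : H} (h : ∀ i, b.repr x i = b.repr y i) : x = y :=
  b.repr.injective (lp.ext (funext h))

theorem summable_norm_sq_repr (x : H) : Summable fun i => ‖b.repr x i‖ ^ 2 :=
  lp_two_summable (b.repr x)

theorem norm_sq_eq_tsum (x : H) : ‖x‖ ^ 2 = ∑' i, ‖b.repr x i‖ ^ 2 := by
  rw [← b.repr.norm_map, lp_two_norm_sq]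

theorem exists_repr_eq {a : ι → ℂ} (h : Summable fun i => ‖a i‖ ^ 2) :
    ∃ x, ∀ i, b.repr x i = a i :=
  ⟨b.repr.symm ⟨a, memℓp_two_of_summable h⟩, fun i => by rw [b.repr.apply_symm_apply]⟩

/-- Vectors are constructed through their coordinates by multiplying those of a known vector by
bounded factors. -/
theorem exists_repr_eq_of_le {a : ι → ℂ} (y : H) (K : ℝ) (h : ∀ i, ‖a i‖ ≤ K * ‖b.repr y i‖) :
    ∃ x, ∀ i, b.repr x i = a i := by
  refine b.exists_repr_eq (((b.summable_norm_sq_repr y).mul_left (K ^ 2)).of_nonneg_of_le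
    (fun i => by positivity) fun i => ?_)
  rw [← mul_pow]
  exact pow_le_pow_left₀ (norm_nonneg _) (h i) 2

theorem repr_add_apply (x y : H) (i : ι) : b.repr (x + y) i = b.repr x i + b.repr y i := by
  rw [map_add, lp.coeFn_add, Pi.add_apply]

theorem repr_sub_apply (x y : H) (i : ι) : b.repr (x - y) i = b.repr x i - b.repr y i := by
  rw [map_sub, lp.coeFn_sub, Pi.sub_apply]

theorem repr_neg_apply (x : H) (i : ι) : b.repr (-x) i = -b.repr x i := by
  rw [map_neg, lp.coeFn_neg, Pi.neg_apply]

theorem repr_smul_apply (a : ℂ) (x : H) (i : ι) : b.repr (a • x) i = a * b.repr x i := by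
  rw [map_smul, lp.coeFn_smul, Pi.smul_apply, smul_eq_mul]

theorem continuous_repr_apply (i : ι) : Continuous fun x => b.repr x i := by
  simp only [b.repr_apply_apply]
  fun_prop

theorem inner_eq_zero_of_repr {x y : H} (h : ∀ i, b.repr x i = 0 ∨ b.repr y i = 0) :
    ⟪x, y⟫_ℂ = 0 := by
  rw [← b.tsum_inner_mul_inner]
  refine (tsum_congr fun i => ?_).trans tsum_zero
  rw [← inner_conj_symm x, ← b.repr_apply_apply, ← b.repr_apply_apply]
  rcases h i with h | h <;> simp [h]

end HilbertBasis

/-- `A` is the multiplication by the positive numbers `ev i`, bounded away from zero, in the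
Hilbert basis `b`. -/
structure LinearPMap.IsDiagonal (A : H →ₗ.[ℂ] H) (b : HilbertBasis ι ℂ H) (ev : ι → ℝ) :
    Prop where
  exists_lower_bound : ∃ δ : ℝ, 0 < δ ∧ ∀ i, δ ≤ ev i
  mem_graph_iff : ∀ x y : H, (x, y) ∈ A.graph ↔ ∀ i, b.repr y i = ev i * b.repr x i

namespace LinearPMap.IsDiagonal

variable {A : H →ₗ.[ℂ] H} {b : HilbertBasis ι ℂ H} {ev : ι → ℝ}

theorem pos (h : A.IsDiagonal b ev) (i : ι) : 0 < ev i := by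
  obtain ⟨δ, hδ, hle⟩ := h.exists_lower_bound
  exact hδ.trans_le (hle i)

theorem repr_apply (h : A.IsDiagonal b ev) (x : A.domain) (i : ι) :
    b.repr (A x) i = ev i * b.repr (x : H) i :=
  (h.mem_graph_iff _ _).1 (A.mem_graph x) i

theorem mem_eigSpace_iff (h : A.IsDiagonal b ev) {σ : ℝ} {x : H} :
    x ∈ A.eigSpace σ ↔ ∀ i, ev i ≠ σ → b.repr x i = 0 := by
  change (x, (σ : ℂ) • x) ∈ A.graph ↔ _
  rw [h.mem_graph_iff]
  refine forall_congr' fun i => ?_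
  rw [b.repr_smul_apply, ← sub_eq_zero, ← sub_mul, mul_eq_zero, sub_eq_zero, Complex.ofReal_inj]
  constructor
  · rintro (h | h) h'
    · exact absurd h.symm h'
    · exact h
  · intro h
    by_cases h' : ev i = σ
    · exact .inl h'.symm
    · exact .inr (h h')

variable [CompleteSpace H]

open scoped Classical in
-- Cutting off all coordinates with `ev i ≠ σ` lands in the eigenspace. The remainder is orthogonal
-- to its closure too, because vanishing of a coordinate is a closed condition.
theorem repr_eigProj (h : A.IsDiagonal b ev) (σ : ℝ) (x : H) (i : ι) :
    b.repr (A.eigProj σ x) i = if ev i = σ then b.repr x i else 0 := by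
  obtain ⟨v, hv⟩ := b.exists_repr_eq_of_le (a := fun i => if ev i = σ then b.repr x i else 0) x 1
    fun i => by split_ifs <;> simp
  have hvE : v ∈ A.eigSpace σ := h.mem_eigSpace_iff.2 fun i hi => by rw [hv, if_neg hi]
  suffices A.eigProj σ x = v by rw [this, hv]
  refine Submodule.eq_starProjection_of_mem_of_inner_eq_zero
    (Submodule.le_topologicalClosure _ hvE) fun w hw => b.inner_eq_zero_of_repr fun i => ?_
  rw [b.repr_sub_apply, hv]
  by_cases hi : ev i = σ
  · left; simp [hi]
  · right
    have hcl : _root_.IsClosed {w | b.repr w i = 0} :=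
      isClosed_eq (b.continuous_repr_apply i) continuous_const
    exact closure_minimal (s := (A.eigSpace σ : Set H))
      (fun w hw => h.mem_eigSpace_iff.1 hw i hi) hcl hw

/-- Eigenspaces for distinct `σ` are orthogonal, so unconditional summability follows from Bessel's
inequality: a finite partial sum retains some coordinates of `y` and kills the others. The index set
is all of `ℝ`, with zero terms off the spectrum. -/
theorem summable_eigProj (h : A.IsDiagonal b ev) (y : H) :
    Summable fun σ : ℝ => A.eigProj σ y := by
  classical
  let V : ℝ → Submodule ℂ H := fun σ => (A.eigSpace σ).topologicalClosure
  have hV : OrthogonalFamily ℂ (fun σ => V σ) fun σ => (V σ).subtypeₗᵢ := by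
    intro σ σ' hne x x'
    have hx : ∀ (σ) (x : V σ), A.eigProj σ x = x := fun σ x =>
      Submodule.starProjection_eq_self_iff.2 x.2
    change ⟪(x : H), (x' : H)⟫_ℂ = 0
    refine b.inner_eq_zero_of_repr fun i => ?_
    rw [← hx, ← hx σ', h.repr_eigProj, h.repr_eigProj]
    by_cases hi : ev i = σ
    · right; rw [if_neg]; rintro rfl; exact hne hi.symm
    · left; rw [if_neg hi]
  let f : ∀ σ, V σ := fun σ => (V σ).orthogonalProjectionOnto y
  have hf : ∀ σ, ((f σ : V σ) : H) = A.eigProj σ y := fun σ => rfl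
  refine (hV.summable_iff_norm_sq_summable f).2 ?_
  refine summable_of_sum_le (c := ‖y‖ ^ 2) (fun σ => by positivity) fun F => ?_
  rw [← hV.norm_sum f F]
  refine pow_le_pow_left₀ (norm_nonneg _) ?_ 2
  rw [← b.repr.norm_map, ← b.repr.norm_map y]
  refine lp.norm_mono (by norm_num) fun i => ?_
  have : b.repr (∑ σ ∈ F, (V σ).subtypeₗᵢ (f σ)) i = if ev i ∈ F then b.repr y i else 0 := by
    rw [b.repr_apply_apply, inner_sum]
    have : ∀ σ ∈ F, ⟪b i, (V σ).subtypeₗᵢ (f σ)⟫_ℂ = if ev i = σ then b.repr y i else 0 :=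
      fun σ _ => by rw [← b.repr_apply_apply]; exact h.repr_eigProj σ y i
    rw [Finset.sum_congr rfl this, Finset.sum_ite_eq]
  rw [this]
  split_ifs <;> simp

/-- The real powers of a diagonal operator are the diagonal operators of the powers. -/
theorem mem_realPow_graph_iff (h : A.IsDiagonal b ev) (s : ℝ) (x y : H) :
    (x, y) ∈ (A.realPow s).graph ↔ ∀ i, b.repr y i = (ev i ^ s : ℝ) * b.repr x i := by
  classical
  have hterm : ∀ σ i, b.repr (((σ ^ s : ℝ) : ℂ) • A.eigProj σ x) i
      = if ev i = σ then ((ev i ^ s : ℝ) : ℂ) * b.repr x i else 0 := fun σ i => by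
    rw [b.repr_smul_apply, h.repr_eigProj]
    split_ifs with h1
    · rw [h1]
    · rw [mul_zero]
  have hsum : Summable (fun σ : ℝ => ((σ ^ s : ℝ) : ℂ) • A.eigProj σ x) →
      ∀ i, b.repr (∑' σ : ℝ, ((σ ^ s : ℝ) : ℂ) • A.eigProj σ x) i
        = (ev i ^ s : ℝ) * b.repr x i := fun hs i => by
    rw [b.repr_apply_apply, ← innerSL_apply_apply ℂ, ContinuousLinearMap.map_tsum _ hs]
    simp only [innerSL_apply_apply, ← b.repr_apply_apply, hterm]
    rw [tsum_eq_single (ev i) fun σ hσ => if_neg hσ.symm, if_pos rfl]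
  rw [LinearPMap.mem_graph_iff]
  constructor
  · rintro ⟨x', rfl, rfl⟩ i
    exact hsum x'.2 i
  · intro hy
    have hs : Summable fun σ : ℝ => ((σ ^ s : ℝ) : ℂ) • A.eigProj σ x := by
      -- The series defining `A ^ s x` is term by term the spectral decomposition of `y`, which
      -- always converges.
      refine (h.summable_eigProj y).congr fun σ => b.ext_repr fun i => ?_
      rw [hterm, h.repr_eigProj, hy]
    exact ⟨⟨x, hs⟩, rfl, b.ext_repr fun i => (hsum hs i).trans (hy i).symm⟩

theorem repr_realPow_apply (h : A.IsDiagonal b ev) (s : ℝ) (x : (A.realPow s).domain) (i : ι) :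
    b.repr (A.realPow s x) i = (ev i ^ s : ℝ) * b.repr (x : H) i :=
  (h.mem_realPow_graph_iff s _ _).1 ((A.realPow s).mem_graph x) i

theorem exists_realPow (h : A.IsDiagonal b ev) (s : ℝ) {x y : H}
    (hxy : ∀ i, b.repr y i = (ev i ^ s : ℝ) * b.repr x i) :
    ∃ z : (A.realPow s).domain, (z : H) = x ∧ A.realPow s z = y := by
  have := (h.mem_realPow_graph_iff s x y).2 hxy
  rwa [LinearPMap.mem_graph_iff] at this

end LinearPMap.IsDiagonal

end Diagonal

/-! ### The plate operator in energy coordinates -/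

section Energy

variable {ι : Type*} {H : Type*} [NormedAddCommGroup H] [InnerProductSpace ℂ H] [CompleteSpace H]
  {A : H →ₗ.[ℂ] H} {b : HilbertBasis ι ℂ H} {ev : ι → ℝ}

/-- The inertia factor `√(1 + γ λ ^ τ)` of the eigenvalue `λ`. -/
noncomputable def inertia (c : PlateCoefficients) (τ x : ℝ) : ℝ := √(1 + c.γ * x ^ τ)

theorem inertia_sq (c : PlateCoefficients) (τ : ℝ) {x : ℝ} (hx : 0 < x) :
    inertia c τ x ^ 2 = 1 + c.γ * x ^ τ := by
  have := c.γ_pos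
  exact Real.sq_sqrt (by positivity)

theorem inertia_pos (c : PlateCoefficients) (τ : ℝ) {x : ℝ} (hx : 0 < x) : 0 < inertia c τ x := by
  have := c.γ_pos
  exact Real.sqrt_pos.2 (by positivity)

theorem rpow_half_sq {x : ℝ} (hx : 0 < x) (τ : ℝ) : (x ^ (τ / 2)) ^ 2 = x ^ τ := by
  rw [← Real.rpow_natCast, ← Real.rpow_mul hx.le]
  norm_num

namespace PlateState

variable {c : PlateCoefficients} {τ : ℝ}

/-- The energy coordinates of a state. -/
noncomputable def coord (b : HilbertBasis ι ℂ H) (ev : ι → ℝ) (U : PlateState A c τ) (i : ι) :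
    EuclideanSpace ℂ (Fin 3) :=
  !₂[(√c.β * ev i : ℝ) * b.repr (U.u : H) i,
    (√c.β * inertia c τ (ev i) : ℝ) * b.repr (U.v : H) i, (√c.α : ℝ) * b.repr U.θ i]

/-- The two parts of the kinetic energy combine through `inertia² = 1 + γ λ^τ`; this dictates the
weights of `coord`. -/
theorem norm_coord_sq (h : A.IsDiagonal b ev) (U : PlateState A c τ) (i : ι) :
    ‖coord b ev U i‖ ^ 2 = c.β * ‖b.repr (A U.u) i‖ ^ 2 + c.β * (‖b.repr (U.v : H) i‖ ^ 2
      + c.γ * ‖b.repr (A.realPow (τ / 2) U.v) i‖ ^ 2) + c.α * ‖b.repr U.θ i‖ ^ 2 := by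
  have hp := h.pos i
  rw [EuclideanSpace.norm_sq_eq, Fin.sum_univ_three, h.repr_apply, h.repr_realPow_apply]
  simp only [coord, Matrix.cons_val_zero, Matrix.cons_val_one, Matrix.cons_val, norm_mul,
    mul_pow, Complex.norm_real, Real.norm_eq_abs, sq_abs, Real.sq_sqrt c.α_pos.le,
    Real.sq_sqrt c.β_pos.le, inertia_sq c τ hp, rpow_half_sq hp]
  ring

/-- Each row is the corresponding scalar equation multiplied by a nonzero weight, so the equivalence
is one of plain algebra. -/
theorem coord_eq_plateBlock_iff (h : A.IsDiagonal b ev) (U F : PlateState A c τ) (i : ι) :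
    coord b ev F i = plateBlock (ev i / inertia c τ (ev i)) (√c.α * √c.β) (c.κ * ev i)
        (coord b ev U i) ↔
      b.repr (F.u : H) i = b.repr (U.v : H) i ∧
      ((1 + c.γ * ev i ^ τ : ℝ) : ℂ) * b.repr (F.v : H) i
        = ev i * (-(ev i * b.repr (U.u : H) i) + c.α * b.repr U.θ i) ∧
      b.repr F.θ i = ev i * (-c.κ * b.repr U.θ i - c.β * b.repr (U.v : H) i) := by
  have hp : (ev i : ℂ) ≠ 0 := by exact_mod_cast (h.pos i).ne'
  have hm : (inertia c τ (ev i) : ℂ) ≠ 0 := by exact_mod_cast (inertia_pos c τ (h.pos i)).ne'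
  have hα : (√c.α : ℂ) ≠ 0 := by exact_mod_cast (Real.sqrt_pos.2 c.α_pos).ne'
  have hβ : (√c.β : ℂ) ≠ 0 := by exact_mod_cast (Real.sqrt_pos.2 c.β_pos).ne'
  have hα2 : (c.α : ℂ) = (√c.α : ℂ) ^ 2 := by exact_mod_cast (Real.sq_sqrt c.α_pos.le).symm
  have hβ2 : (c.β : ℂ) = (√c.β : ℂ) ^ 2 := by exact_mod_cast (Real.sq_sqrt c.β_pos.le).symm
  rw [← inertia_sq c τ (h.pos i), PiLp.ext_iff, Fin.forall_fin_succ, Fin.forall_fin_two,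
    plateBlock_apply, hα2, hβ2]
  simp only [coord, Matrix.cons_val_zero, Matrix.cons_val_one, Matrix.cons_val, Fin.succ_zero_eq_one,
    Fin.succ_one_eq_two]
  push_cast
  generalize (√c.α : ℂ) = p at *
  generalize (√c.β : ℂ) = q at *
  generalize (inertia c τ (ev i) : ℂ) = m at *
  generalize (ev i : ℂ) = e at *
  refine and_congr ?_ (and_congr ?_ ?_)
  · rw [← mul_right_inj' (mul_ne_zero hβ hp)]
    field_simp
  · rw [← mul_right_inj' (div_ne_zero hβ hm)]
    field_simp
  · rw [← mul_right_inj' hα]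
    field_simp

/-- The plate operator acts on the energy coordinates by the blocks. -/
theorem mem_plateGraph_iff (h : A.IsDiagonal b ev) (hτ : 0 ≤ τ) (U F : PlateState A c τ) :
    (U, F) ∈ plateGraph A c τ ↔ ∀ i, coord b ev F i =
      plateBlock (ev i / inertia c τ (ev i)) (√c.α * √c.β) (c.κ * ev i) (coord b ev U i) := by
  classical
  simp only [coord_eq_plateBlock_iff h]
  have hcomb : ∀ i, b.repr (-A U.u + (c.α : ℂ) • U.θ) i
      = -(ev i * b.repr (U.u : H) i) + c.α * b.repr U.θ i := fun i => by
    rw [b.repr_add_apply, b.repr_neg_apply, b.repr_smul_apply, h.repr_apply]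
  have hcomb' : ∀ i, b.repr (-(c.κ : ℂ) • U.θ - (c.β : ℂ) • (U.v : H)) i
      = -c.κ * b.repr U.θ i - c.β * b.repr (U.v : H) i := fun i => by
    rw [b.repr_sub_apply, b.repr_smul_apply, b.repr_smul_apply]
  have hpow : ∀ i, ev i ^ (τ / 2) * ev i ^ (1 - τ / 2) = ev i := fun i => by
    rw [← Real.rpow_add (h.pos i)]; simp
  have hpowC : ∀ i, ((ev i ^ (τ / 2) : ℝ) : ℂ) * ((ev i ^ (1 - τ / 2) : ℝ) : ℂ) = ev i := fun i => by
    rw [← Complex.ofReal_mul, hpow]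
  constructor
  · rintro ⟨h1, ⟨w, hw, h2⟩, h3⟩ i
    simp only at h1 h2 h3 hw
    refine ⟨by rw [h1], ?_, ?_⟩
    · rw [h.mem_realPow_graph_iff] at hw
      have hwi := hw i
      rw [hcomb] at hwi
      -- Testing the weak identity with the basis vector `b i` isolates its `i`-th coordinate.
      obtain ⟨z, hz, hz'⟩ := h.exists_realPow (τ / 2) (x := b i)
        (y := ((ev i ^ (τ / 2) : ℝ) : ℂ) • b i) fun j => by
          rw [b.repr_smul_apply, b.repr_self, lp.single_apply]
          by_cases hij : j = i
          · rw [hij]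
          · simp [hij]
      have h4 := h2 z
      rw [hz, hz', inner_smul_left, inner_smul_left, ← b.repr_apply_apply, ← b.repr_apply_apply,
        ← b.repr_apply_apply, h.repr_realPow_apply, hwi, Complex.conj_ofReal] at h4
      rw [← rpow_half_sq (h.pos i)]
      push_cast
      linear_combination h4 + (-(ev i * b.repr (U.u : H) i) + c.α * b.repr U.θ i) * hpowC i
    · rw [← hcomb']
      exact (h.mem_graph_iff _ _).1 h3 i
  · intro hi
    obtain ⟨δ, hδ, hle⟩ := h.exists_lower_bound
    have hhalf : ∀ i, 0 < ev i ^ (τ / 2) := fun i => Real.rpow_pos_of_pos (h.pos i) _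
    -- Here `y = A^{-τ/2} F.v`, which exists because the eigenvalues are at least `δ` and `τ ≥ 0`.
    -- The weak identity then leaves only `w = y + γ A^{τ/2} F.v` as a choice.
    obtain ⟨y, hy⟩ := b.exists_repr_eq_of_le
      (a := fun i => (((ev i ^ (τ / 2))⁻¹ : ℝ) : ℂ) * b.repr (F.v : H) i) F.v (δ ^ (τ / 2))⁻¹
      fun i => by
        rw [norm_mul, Complex.norm_real, Real.norm_of_nonneg (inv_nonneg.2 (hhalf i).le)]
        gcongr
        exact hle i
    refine ⟨b.ext_repr fun i => (hi i).1.symm,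
      ⟨y + (c.γ : ℂ) • A.realPow (τ / 2) F.v, ?_, fun z => ?_⟩, ?_⟩
    · rw [h.mem_realPow_graph_iff]
      intro i
      rw [hcomb, b.repr_add_apply, b.repr_smul_apply, h.repr_realPow_apply, hy]
      have hne : ((ev i ^ (τ / 2) : ℝ) : ℂ) ≠ 0 := by exact_mod_cast (hhalf i).ne'
      have hinv : ((ev i ^ (τ / 2) : ℝ) : ℂ) * (((ev i ^ (τ / 2))⁻¹ : ℝ) : ℂ) = 1 := by
        rw [Complex.ofReal_inv, mul_inv_cancel₀ hne]
      have key := (hi i).2.1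
      rw [← rpow_half_sq (h.pos i)] at key
      push_cast at key
      refine mul_left_cancel₀ hne ?_
      linear_combination b.repr (F.v : H) i * hinv + key
        - (-(ev i * b.repr (U.u : H) i) + c.α * b.repr U.θ i) * hpowC i
    · rw [inner_add_right, inner_smul_right]
      congr 1
      rw [← b.tsum_inner_mul_inner, ← b.tsum_inner_mul_inner (A.realPow (τ / 2) z)]
      refine tsum_congr fun i => ?_
      have hne : ((ev i ^ (τ / 2) : ℝ) : ℂ) ≠ 0 := by exact_mod_cast (hhalf i).ne'
      rw [← inner_conj_symm, ← inner_conj_symm (A.realPow (τ / 2) z), ← b.repr_apply_apply,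
        ← b.repr_apply_apply, ← b.repr_apply_apply, ← b.repr_apply_apply, hy,
        h.repr_realPow_apply, map_mul, Complex.conj_ofReal, Complex.ofReal_inv]
      field_simp
    · rw [h.mem_graph_iff]
      intro i
      rw [hcomb']
      exact (hi i).2.2

variable [hA : Fact (Function.Injective A)]

theorem norm_sq_eq (U : PlateState A c τ) : ‖U‖ ^ 2 = c.β * ‖A U.u‖ ^ 2 + c.β * (‖(U.v : H)‖ ^ 2
    + c.γ * ‖A.realPow (τ / 2) U.v‖ ^ 2) + c.α * ‖U.θ‖ ^ 2 := by
  have h : ((‖U‖ : ℂ)) ^ 2 = energyInner U U :=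
    (inner_self_eq_norm_sq_to_K (𝕜 := ℂ) U).symm
  rw [energyInner_self] at h
  exact_mod_cast h

theorem hasSum_norm_coord_sq (h : A.IsDiagonal b ev) (U : PlateState A c τ) :
    HasSum (fun i => ‖coord b ev U i‖ ^ 2) (‖U‖ ^ 2) := by
  have hs : ∀ x : H, HasSum (fun i => ‖b.repr x i‖ ^ 2) (‖x‖ ^ 2) := fun x => by
    rw [b.norm_sq_eq_tsum]; exact (b.summable_norm_sq_repr x).hasSum
  simp only [norm_coord_sq h, norm_sq_eq]
  exact (((hs _).mul_left _).add (((hs _).add ((hs _).mul_left _)).mul_left _)).add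
    ((hs _).mul_left _)

/-- The energy coordinates, as an isometry. -/
noncomputable def coordIsometry (h : A.IsDiagonal b ev) :
    PlateState A c τ →ₗᵢ[ℂ] lp (fun _ : ι => EuclideanSpace ℂ (Fin 3)) 2 where
  toFun U := ⟨coord b ev U, memℓp_two_of_summable (hasSum_norm_coord_sq h U).summable⟩
  map_add' U V := by
    ext i j
    change coord b ev (U + V) i j = coord b ev U i j + coord b ev V i j
    fin_cases j <;>
      simp [coord, mul_add]
  map_smul' a U := by
    ext i j
    change coord b ev (a • U) i j = a * coord b ev U i j
    fin_cases j <;>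
      simp [coord] <;> ring
  norm_map' U := by
    refine (pow_left_inj₀ (norm_nonneg _) (norm_nonneg _) two_ne_zero).1 ?_
    rw [lp_two_norm_sq]
    exact (hasSum_norm_coord_sq h U).tsum_eq

theorem coordIsometry_apply (h : A.IsDiagonal b ev) (U : PlateState A c τ) (i : ι) :
    coordIsometry h U i = coord b ev U i := rfl

/-- Prescribed coordinates are divided by their weights, which are bounded below. The domain
conditions hold automatically: `λ u` is a multiple of the prescribed sequence, and `√γ λ^{τ/2}` is
dominated by the inertia factor. -/
theorem coordIsometry_surjective (h : A.IsDiagonal b ev) :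
    Function.Surjective (coordIsometry h : PlateState A c τ → _) := by
  intro f
  have hα := Real.sqrt_pos.2 c.α_pos
  have hβ := Real.sqrt_pos.2 c.β_pos
  obtain ⟨δ, hδ, hle⟩ := h.exists_lower_bound
  have hcomp : ∀ j : Fin 3, ∃ y, ∀ i, b.repr y i = f i j := fun j => by
    refine b.exists_repr_eq ((lp_two_summable f).of_nonneg_of_le (fun i => by positivity)
      fun i => ?_)
    exact pow_le_pow_left₀ (norm_nonneg _) (PiLp.norm_apply_le _ _) 2
  obtain ⟨y0, hy0⟩ := hcomp 0
  obtain ⟨y1, hy1⟩ := hcomp 1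
  obtain ⟨y2, hy2⟩ := hcomp 2
  obtain ⟨u, hu⟩ := b.exists_repr_eq_of_le
    (a := fun i => ((√c.β * ev i)⁻¹ : ℝ) * b.repr y0 i) y0 (√c.β * δ)⁻¹ fun i => by
      have hp := h.pos i
      rw [norm_mul, Complex.norm_real, Real.norm_of_nonneg (by positivity)]
      gcongr
      exact hle i
  obtain ⟨v, hv⟩ := b.exists_repr_eq_of_le
    (a := fun i => ((√c.β * inertia c τ (ev i))⁻¹ : ℝ) * b.repr y1 i) y1 (√c.β * 1)⁻¹ fun i => by
      have hp := h.pos i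
      have hm := inertia_pos c τ hp
      have hγ := c.γ_pos
      rw [norm_mul, Complex.norm_real, Real.norm_of_nonneg (by positivity)]
      gcongr
      exact Real.one_le_sqrt.2 (by have : 0 ≤ c.γ * ev i ^ τ := by positivity
                                   linarith)
  obtain ⟨u', hu'⟩ := (LinearPMap.mem_graph_iff A).1 <|
    (h.mem_graph_iff u ((√c.β : ℂ)⁻¹ • y0)).2 fun i => by
      have hp := (h.pos i).ne'
      rw [b.repr_smul_apply, hu]
      have : (ev i : ℂ) ≠ 0 := by exact_mod_cast hp
      push_cast
      field_simp
  obtain ⟨w, hw⟩ := b.exists_repr_eq_of_le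
    (a := fun i => ((ev i ^ (τ / 2) : ℝ) : ℂ) * b.repr v i) y1 (√c.β * √c.γ)⁻¹ fun i => by
      have hp := h.pos i
      have hm := inertia_pos c τ hp
      have hγ := Real.sqrt_pos.2 c.γ_pos
      have hk : √c.γ * ev i ^ (τ / 2) ≤ inertia c τ (ev i) := by
        refine Real.le_sqrt_of_sq_le ?_
        rw [mul_pow, Real.sq_sqrt c.γ_pos.le, rpow_half_sq hp]
        linarith
      rw [hv, norm_mul, norm_mul, Complex.norm_real, Complex.norm_real,
        Real.norm_of_nonneg (by positivity), Real.norm_of_nonneg (by positivity), ← mul_assoc]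
      gcongr
      rw [mul_inv, mul_inv, mul_left_comm]
      gcongr
      rw [← div_eq_mul_inv, div_le_iff₀ hm, ← div_eq_inv_mul, le_div_iff₀ hγ]
      linarith
  obtain ⟨v', hv', -⟩ := h.exists_realPow (τ / 2) hw
  refine ⟨⟨u', v', (√c.α : ℂ)⁻¹ • y2⟩, ?_⟩
  ext i j
  rw [coordIsometry_apply]
  have hp : (ev i : ℂ) ≠ 0 := by exact_mod_cast (h.pos i).ne'
  have hm : (inertia c τ (ev i) : ℂ) ≠ 0 := by exact_mod_cast (inertia_pos c τ (h.pos i)).ne'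
  have hα' : (√c.α : ℂ) ≠ 0 := by exact_mod_cast hα.ne'
  have hβ' : (√c.β : ℂ) ≠ 0 := by exact_mod_cast hβ.ne'
  fin_cases j
  · simp only [coord, hu'.1, hu, hy0]
    simp
    field_simp
  · simp only [coord, hv', hv, hy1]
    simp
    field_simp
  · simp only [coord, b.repr_smul_apply, hy2]
    simp
    field_simp

/-- The phase space is isometric to a Hilbert sum of copies of `ℂ³`. -/
noncomputable def coordEquiv (h : A.IsDiagonal b ev) :
    PlateState A c τ ≃ₗᵢ[ℂ] lp (fun _ : ι => EuclideanSpace ℂ (Fin 3)) 2 :=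
  LinearIsometryEquiv.ofSurjective (coordIsometry h) (coordIsometry_surjective h)

theorem coordEquiv_apply (h : A.IsDiagonal b ev) (U : PlateState A c τ) (i : ι) :
    coordEquiv h U i = coord b ev U i := rfl

end PlateState

variable [hA : Fact (Function.Injective A)]

theorem exists_plateSemigroup (h : A.IsDiagonal b ev) (c : PlateCoefficients) {τ : ℝ} (hτ : 0 ≤ τ) :
    ∃ S : StronglyContinuousSemigroup (PlateState A c τ), S.IsGeneratedBy (plateOperator A c τ) := by
  obtain ⟨S, hS⟩ := exists_semigroup_of_dissipative
    (PlateState.coordEquiv (c := c) (τ := τ) h)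
    (fun i => plateBlock (ev i / inertia c τ (ev i)) (√c.α * √c.β) (c.κ * ev i))
    fun i x => plateBlock_dissipative _ _ (mul_pos c.κ_pos (h.pos i)).le x
  refine ⟨S, fun x y => ?_⟩
  rw [hS, mem_graph_plateOperator, PlateState.mem_plateGraph_iff h hτ]
  rfl

theorem plateSemigroup_not_isAnalytic (h : A.IsDiagonal b ev) (hev : ¬ BddAbove (range ev))
    (c : PlateCoefficients) {τ : ℝ} (hτ : τ ∈ Ioc (0 : ℝ) 1)
    (S : StronglyContinuousSemigroup (PlateState A c τ))
    (hS : S.IsGeneratedBy (plateOperator A c τ)) : ¬ S.IsAnalytic := by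
  classical
  have : CompleteSpace (PlateState A c τ) :=
    (PlateState.coordEquiv (c := c) (τ := τ) h).toIsometryEquiv.completeSpace
  have hk : 0 < √c.α * √c.β := mul_pos (Real.sqrt_pos.2 c.α_pos) (Real.sqrt_pos.2 c.β_pos)
  have hseq : ∀ j : ℕ, ∃ i, (j : ℝ) < ev i := fun j => by
    by_contra! hj
    exact hev ⟨j, by rintro _ ⟨i, rfl⟩; exact hj i⟩
  choose idx hidx using hseq
  have htend : Tendsto (fun j => ev (idx j)) atTop atTop :=
    tendsto_atTop_mono (fun j => (hidx j).le) tendsto_natCast_atTop_atTop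
  obtain ⟨N, μ, hμ, hpos, him0, him, hre⟩ :=
    exists_characteristic_roots c.γ_pos hτ c.κ_pos hk htend
  let ω' : ℕ → ℝ := fun j => ev (idx (j + N)) / inertia c τ (ev (idx (j + N)))
  let Λ : ℕ → ℝ := fun j => c.κ * ev (idx (j + N))
  let e : ℕ → EuclideanSpace ℂ (Fin 3) := fun j =>
    !₂[(ω' j : ℂ) * (μ j + Λ j), μ j * (μ j + Λ j), -((√c.α * √c.β : ℝ) : ℂ) * ω' j * μ j]
  let w : ℕ → PlateState A c τ := fun j =>
    (PlateState.coordEquiv h).symm (lp.single 2 (idx (j + N)) (e j))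
  have hcoord : ∀ j i, PlateState.coord b ev (w j) i = if i = idx (j + N) then e j else 0 := by
    intro j i
    rw [← PlateState.coordEquiv_apply h]
    simp only [w, LinearIsometryEquiv.apply_symm_apply]
    rw [lp.single_apply]
    by_cases hi : i = idx (j + N)
    · subst hi; simp
    · simp [hi]
  refine StronglyContinuousSemigroup.not_isAnalytic_of_eigenvalues hS μ w (fun j h0 => ?_)
    (fun j => ?_) him hre
  · have h1 := hcoord j (idx (j + N))
    rw [h0, if_pos rfl, ← PlateState.coordEquiv_apply h, map_zero] at h1
    have h2 : (0 : ℂ) = (ω' j : ℂ) * (μ j + Λ j) := congrArg (fun x => x 0) h1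
    have h3 : (ω' j : ℂ) ≠ 0 := by
      have := (div_pos (hpos j) (inertia_pos c τ (hpos j))).ne'
      exact_mod_cast this
    -- If the eigenvector vanished, `μ = -Λ` would be real, contrary to `Im μ > 0`.
    have h4 : μ j + Λ j = 0 := (mul_eq_zero.1 h2.symm).resolve_left h3
    have h5 := congrArg Complex.im h4
    simp at h5
    exact (him0 j).ne' h5
  · rw [mem_graph_plateOperator, PlateState.mem_plateGraph_iff h hτ.1.le]
    intro i
    rw [← PlateState.coordEquiv_apply h, map_smul, lp.coeFn_smul, Pi.smul_apply,
      PlateState.coordEquiv_apply h, hcoord]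
    split_ifs with hi
    · rw [hi]
      exact (plateBlock_eigenvector (hμ j)).symm
    · rw [smul_zero, map_zero]

end Energy

/-! ### Approximation of test functions by step functions -/

section Translation

open scoped ENNReal

variable {E : Type*} [NormedAddCommGroup E] [NormedSpace ℝ E]

theorem sq_setLIntegral_Ioc_zero_one_le {f : ℝ → ℝ≥0∞} (hf : Measurable f) :
    (∫⁻ t in Ioc (0 : ℝ) 1, f t) ^ 2 ≤ ∫⁻ t in Ioc (0 : ℝ) 1, f t ^ 2 := by
  have h := ENNReal.lintegral_mul_le_Lp_mul_Lq (volume.restrict (Ioc (0 : ℝ) 1))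
    Real.HolderConjugate.two_two (f := f) (g := fun _ => 1) hf.aemeasurable
    aemeasurable_const
  simp only [Pi.mul_apply, mul_one, ENNReal.one_rpow, lintegral_const,
    Measure.restrict_apply MeasurableSet.univ, univ_inter, Real.volume_Ioc, sub_zero,
    ENNReal.ofReal_one] at h
  calc _ ≤ ((∫⁻ t in Ioc (0 : ℝ) 1, f t ^ (2 : ℝ)) ^ (1 / 2 : ℝ)) ^ 2 := by gcongr
    _ = ∫⁻ t in Ioc (0 : ℝ) 1, f t ^ (2 : ℝ) := by
      rw [← ENNReal.rpow_natCast, ← ENNReal.rpow_mul]; norm_num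
    _ = _ := by simp only [ENNReal.rpow_two]

theorem enorm_translate_sub_sq_le {φ : E → ℂ} (hφ : ContDiff ℝ 1 φ) (y z : E) :
    ‖φ (y + z) - φ y‖ₑ ^ 2 ≤ ∫⁻ t in Ioc (0 : ℝ) 1, ‖fderiv ℝ φ (y + t • z) z‖ₑ ^ 2 := by
  have hc : Continuous fun t : ℝ => fderiv ℝ φ (y + t • z) z := by
    have := hφ.continuous_fderiv one_ne_zero
    fun_prop
  have hd : ∀ t : ℝ, HasDerivAt (fun t : ℝ => φ (y + t • z)) (fderiv ℝ φ (y + t • z) z) t :=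
    fun t => by
      have h1 : HasDerivAt (fun t : ℝ => y + t • z) z t := by
        simpa using ((hasDerivAt_id t).smul_const z).const_add y
      exact (hφ.differentiable one_ne_zero (y + t • z)).hasFDerivAt.comp_hasDerivAt t h1
  have h := intervalIntegral.integral_eq_sub_of_hasDerivAt (a := 0) (b := 1)
    (fun t _ => hd t) (hc.intervalIntegrable 0 1)
  rw [one_smul, zero_smul, add_zero, intervalIntegral.integral_of_le zero_le_one] at h
  rw [← h]
  refine le_trans ?_ (sq_setLIntegral_Ioc_zero_one_le hc.measurable.enorm)
  gcongr
  exact enorm_integral_le_lintegral_enorm _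

variable [MeasurableSpace E] [BorelSpace E]

/-- Write the increment as an integral of the derivative along the segment, apply Cauchy–Schwarz in
`t`, and use Tonelli and translation invariance to remove the shift `t z`. -/
theorem lintegral_enorm_translate_sub_sq_le {φ : E → ℂ} (hφ : ContDiff ℝ 1 φ) (μ : Measure E)
    [SFinite μ] [μ.IsAddRightInvariant] (z : E) :
    ∫⁻ y, ‖φ (y + z) - φ y‖ₑ ^ 2 ∂μ ≤ ∫⁻ y, ‖fderiv ℝ φ y z‖ₑ ^ 2 ∂μ := by
  have hcf := hφ.continuous_fderiv one_ne_zero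
  have hm : Measurable (Function.uncurry fun (y : E) (t : ℝ) =>
      ‖fderiv ℝ φ (y + t • z) z‖ₑ ^ 2) := by
    have : Continuous fun p : E × ℝ => fderiv ℝ φ (p.1 + p.2 • z) z := by fun_prop
    exact this.measurable.enorm.pow_const 2
  calc ∫⁻ y, ‖φ (y + z) - φ y‖ₑ ^ 2 ∂μ
      ≤ ∫⁻ y, (∫⁻ t in Ioc (0 : ℝ) 1, ‖fderiv ℝ φ (y + t • z) z‖ₑ ^ 2) ∂μ :=
        lintegral_mono fun y => enorm_translate_sub_sq_le hφ y z
    _ = ∫⁻ t in Ioc (0 : ℝ) 1, ∫⁻ y, ‖fderiv ℝ φ (y + t • z) z‖ₑ ^ 2 ∂μ :=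
        lintegral_lintegral_swap hm.aemeasurable
    _ = ∫⁻ _ in Ioc (0 : ℝ) 1, ∫⁻ y, ‖fderiv ℝ φ y z‖ₑ ^ 2 ∂μ := by
        refine lintegral_congr fun t => ?_
        exact lintegral_add_right_eq_self (fun y => ‖fderiv ℝ φ y z‖ₑ ^ 2) (t • z)
    _ = ∫⁻ y, ‖fderiv ℝ φ y z‖ₑ ^ 2 ∂μ := by simp

end Translation

/-! ### A Poincaré inequality on the cubes of a grid -/

section Grid

open scoped ENNReal

variable {n : ℕ}

theorem norm_fderiv_apply_sq_le (φ : EuclideanSpace ℝ (Fin n) → ℂ)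
    (x z : EuclideanSpace ℝ (Fin n)) :
    ‖fderiv ℝ φ x z‖ ^ 2 ≤ ‖z‖ ^ 2 * ∑ i, ‖PlateDomain.pderiv φ i x‖ ^ 2 := by
  have h : fderiv ℝ φ x z = ∑ i, z i • PlateDomain.pderiv φ i x := by
    conv_lhs => rw [← (EuclideanSpace.basisFun (Fin n) ℝ).sum_repr z]
    simp [PlateDomain.pderiv]
  rw [h, EuclideanSpace.norm_sq_eq]
  calc ‖∑ i, z i • PlateDomain.pderiv φ i x‖ ^ 2
      ≤ (∑ i, ‖z i‖ * ‖PlateDomain.pderiv φ i x‖) ^ 2 := by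
        gcongr
        refine (norm_sum_le _ _).trans (Finset.sum_le_sum fun i _ => ?_)
        rw [norm_smul]
    _ ≤ _ := Finset.sum_mul_sq_le_sq_mul_sq _ _ _

/-- The half-open cube with edge `h` and index `k` of the grid `h ℤⁿ`. -/
def gridCube (h : ℝ) (k : Fin n → ℤ) : Set (EuclideanSpace ℝ (Fin n)) :=
  {x | ∀ i, x i ∈ Ico (h * k i) (h * k i + h)}

/-- The closed cube with centre `0` and edge `2h`. -/
def centredCube (n : ℕ) (h : ℝ) : Set (EuclideanSpace ℝ (Fin n)) := {x | ∀ i, x i ∈ Icc (-h) h}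

theorem measurableSet_gridCube (h : ℝ) (k : Fin n → ℤ) : MeasurableSet (gridCube h k) := by
  have : gridCube h k = ⋂ i, (fun x : EuclideanSpace ℝ (Fin n) => x i) ⁻¹'
      Ico (h * k i) (h * k i + h) := by ext; simp [gridCube]
  rw [this]
  exact .iInter fun i => measurableSet_Ico.preimage (by fun_prop)

theorem measurableSet_centredCube (h : ℝ) : MeasurableSet (centredCube n h) := by
  have : centredCube n h = ⋂ i, (fun x : EuclideanSpace ℝ (Fin n) => x i) ⁻¹'
      Icc (-h) h := by ext; simp [centredCube]
  rw [this]
  exact .iInter fun i => measurableSet_Icc.preimage (by fun_prop)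

theorem volume_gridCube (h : ℝ) (k : Fin n → ℤ) :
    volume (gridCube h k) = ENNReal.ofReal h ^ n := by
  have : gridCube h k = (WithLp.ofLp : EuclideanSpace ℝ (Fin n) → Fin n → ℝ) ⁻¹'
      (univ.pi fun i => Ico (h * k i) (h * k i + h)) := by ext; simp [gridCube]
  rw [this, (PiLp.volume_preserving_ofLp (Fin n)).measure_preimage
    (MeasurableSet.univ_pi fun i => measurableSet_Ico).nullMeasurableSet, Real.volume_pi_Ico]
  simp

theorem volume_centredCube (h : ℝ) :
    volume (centredCube n h) = 2 ^ n * ENNReal.ofReal h ^ n := by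
  have : centredCube n h = (WithLp.ofLp : EuclideanSpace ℝ (Fin n) → Fin n → ℝ) ⁻¹'
      (Icc (fun _ => -h) fun _ => h) := by
    ext; simp [centredCube, Pi.le_def, forall_and]
  rw [this, (PiLp.volume_preserving_ofLp (Fin n)).measure_preimage
    measurableSet_Icc.nullMeasurableSet, Real.volume_Icc_pi]
  simp only [sub_neg_eq_add, ← two_mul, Finset.prod_const, Finset.card_univ, Fintype.card_fin]
  rw [ENNReal.ofReal_mul zero_le_two, mul_pow, ENNReal.ofReal_ofNat]

theorem mem_gridCube_floor {h : ℝ} (hh : 0 < h) (x : EuclideanSpace ℝ (Fin n)) :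
    x ∈ gridCube h fun i => ⌊x i / h⌋ := fun i => by
  have h1 := Int.floor_le (x i / h)
  have h2 := Int.lt_floor_add_one (x i / h)
  rw [le_div_iff₀ hh] at h1
  rw [div_lt_iff₀ hh] at h2
  constructor <;> nlinarith

theorem eq_floor_of_mem_gridCube {h : ℝ} (hh : 0 < h) {x : EuclideanSpace ℝ (Fin n)}
    {k : Fin n → ℤ} (hx : x ∈ gridCube h k) : k = fun i => ⌊x i / h⌋ := by
  funext i
  obtain ⟨h1, h2⟩ := hx i
  symm
  rw [Int.floor_eq_iff, le_div_iff₀ hh, div_lt_iff₀ hh]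
  constructor <;> nlinarith

theorem pairwise_disjoint_gridCube {h : ℝ} (hh : 0 < h) :
    Pairwise (Function.onFun Disjoint (gridCube (n := n) h)) := fun _ _ hkl =>
  Set.disjoint_left.2 fun _ hx hy =>
    hkl ((eq_floor_of_mem_gridCube hh hx).trans (eq_floor_of_mem_gridCube hh hy).symm)

theorem sub_mem_centredCube {h : ℝ} {k : Fin n → ℤ} {x y : EuclideanSpace ℝ (Fin n)}
    (hx : x ∈ gridCube h k) (hy : y ∈ gridCube h k) : x - y ∈ centredCube n h := fun i => by
  have h1 := hx i
  have h2 := hy i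
  simp only [PiLp.sub_apply, mem_Ico, mem_Icc] at *
  constructor <;> linarith

theorem norm_sq_le_of_mem_centredCube {h : ℝ} {z : EuclideanSpace ℝ (Fin n)}
    (hz : z ∈ centredCube n h) : ‖z‖ ^ 2 ≤ n * h ^ 2 := by
  rw [EuclideanSpace.norm_sq_eq]
  calc ∑ i, ‖z i‖ ^ 2 ≤ ∑ _i : Fin n, h ^ 2 :=
        Finset.sum_le_sum fun i _ => by
          rw [Real.norm_eq_abs]
          exact pow_le_pow_left₀ (abs_nonneg _) (abs_le.2 (hz i)) 2
    _ = n * h ^ 2 := by simp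

theorem exists_finset_gridCube {s : Set (EuclideanSpace ℝ (Fin n))} (hs : Bornology.IsBounded s)
    {h : ℝ} (hh : 0 < h) : ∃ F : Finset (Fin n → ℤ), s ⊆ ⋃ k ∈ F, gridCube h k := by
  obtain ⟨R, hR⟩ := hs.exists_norm_le
  refine ⟨Fintype.piFinset fun _ => Finset.Icc ⌊-R / h⌋ ⌊R / h⌋, fun x hx => ?_⟩
  refine mem_iUnion₂.2 ⟨fun i => ⌊x i / h⌋, ?_, mem_gridCube_floor hh x⟩
  rw [Fintype.mem_piFinset]
  intro i
  have h1 := abs_le.1 (((Real.norm_eq_abs _).symm.trans_le (PiLp.norm_apply_le x i)).trans (hR x hx))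
  rw [Finset.mem_Icc]
  constructor
  · exact Int.floor_le_floor (by gcongr; exact h1.1)
  · exact Int.floor_le_floor (by gcongr; exact h1.2)

/-- On every cube of the grid a smooth function is close in the mean to one of its values. -/
theorem exists_gridCube_values {φ : EuclideanSpace ℝ (Fin n) → ℂ} (hφ : ContDiff ℝ 1 φ) {h : ℝ}
    (hh : 0 < h) (F : Finset (Fin n → ℤ)) : ∃ a : (Fin n → ℤ) → ℂ,
    ∑ k ∈ F, ∫⁻ x in gridCube h k, ‖φ x - a k‖ₑ ^ 2 ≤
      ENNReal.ofReal (2 ^ n * (n * h ^ 2)) * ∑ i, ∫⁻ x, ‖PlateDomain.pderiv φ i x‖ₑ ^ 2 := by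
  have hc : Continuous φ := hφ.continuous
  have hV0 : ENNReal.ofReal h ^ n ≠ 0 := pow_ne_zero _ (by simpa using hh)
  have hVt : ENNReal.ofReal h ^ n ≠ ⊤ := ENNReal.pow_ne_top ENNReal.ofReal_ne_top
  have hm2 : Measurable (Function.uncurry fun y x : EuclideanSpace ℝ (Fin n) =>
      ‖φ x - φ y‖ₑ ^ 2) := by
    have : Continuous fun p : EuclideanSpace ℝ (Fin n) × EuclideanSpace ℝ (Fin n) =>
        φ p.2 - φ p.1 := by fun_prop
    exact this.measurable.enorm.pow_const 2
  have hm3 : Measurable (Function.uncurry fun y z : EuclideanSpace ℝ (Fin n) =>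
      ‖φ (y + z) - φ y‖ₑ ^ 2) := by
    have : Continuous fun p : EuclideanSpace ℝ (Fin n) × EuclideanSpace ℝ (Fin n) =>
        φ (p.1 + p.2) - φ p.1 := by fun_prop
    exact this.measurable.enorm.pow_const 2
  -- Instead of the mean over the cube, take a value `φ y` at a point where the quadratic error does
  -- not exceed its average over all `y` in the cube.
  have hchoice : ∀ k : Fin n → ℤ, ∃ y ∈ gridCube h k,
      ∫⁻ x in gridCube h k, ‖φ x - φ y‖ₑ ^ 2 ≤
        (ENNReal.ofReal h ^ n)⁻¹ * ∫⁻ y in gridCube h k, ∫⁻ x in gridCube h k, ‖φ x - φ y‖ₑ ^ 2 :=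
    fun k => by
      have := exists_le_setLAverage (μ := volume) (s := gridCube h k)
        (f := fun y => ∫⁻ x in gridCube h k, ‖φ x - φ y‖ₑ ^ 2) (by rwa [volume_gridCube])
        (by rwa [volume_gridCube]) (Measurable.lintegral_prod_right hm2).aemeasurable
      rwa [setLAverage_eq, volume_gridCube, ENNReal.div_eq_inv_mul] at this
  choose y _ hy using hchoice
  -- Substituting `x = y + z` embeds the shifts in one fixed cube. The double integrals over all
  -- grid cubes then sum to a single integral of translation differences.
  have hinner : ∀ k : Fin n → ℤ, ∀ y ∈ gridCube h k, ∫⁻ x in gridCube h k, ‖φ x - φ y‖ₑ ^ 2 ≤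
      ∫⁻ z in centredCube n h, ‖φ (y + z) - φ y‖ₑ ^ 2 := fun k y hy => by
    rw [← lintegral_indicator (measurableSet_gridCube h k),
      ← lintegral_indicator (measurableSet_centredCube h),
      ← lintegral_add_left_eq_self _ y]
    refine lintegral_mono fun z => ?_
    by_cases hz : y + z ∈ gridCube h k
    · have : z ∈ centredCube n h := by simpa using sub_mem_centredCube hz hy
      rw [indicator_of_mem hz, indicator_of_mem this]
    · rw [indicator_of_notMem hz]; exact zero_le
  have hz : ∀ z ∈ centredCube n h, ∫⁻ y, ‖φ (y + z) - φ y‖ₑ ^ 2 ≤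
      ENNReal.ofReal (n * h ^ 2) * ∑ i, ∫⁻ x, ‖PlateDomain.pderiv φ i x‖ₑ ^ 2 := fun z hz => by
    refine (lintegral_enorm_translate_sub_sq_le hφ volume z).trans ?_
    have hmi : ∀ i, Measurable fun x => ‖PlateDomain.pderiv φ i x‖ₑ ^ 2 := fun i => by
      have : Continuous fun x => PlateDomain.pderiv φ i x := by
        have := hφ.continuous_fderiv one_ne_zero
        unfold PlateDomain.pderiv
        fun_prop
      exact this.measurable.enorm.pow_const 2
    rw [← lintegral_finsetSum _ fun i _ => hmi i,
      ← lintegral_const_mul _ (Finset.measurable_sum _ fun i _ => hmi i)]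
    refine lintegral_mono fun x => ?_
    have h1 := (norm_fderiv_apply_sq_le φ x z).trans
      (mul_le_mul_of_nonneg_right (norm_sq_le_of_mem_centredCube hz)
        (Finset.sum_nonneg fun i _ => sq_nonneg _))
    have h2 := ENNReal.ofReal_le_ofReal h1
    rw [ENNReal.ofReal_mul (by positivity), ENNReal.ofReal_sum_of_nonneg fun i _ => sq_nonneg _]
      at h2
    simpa only [ENNReal.ofReal_pow (norm_nonneg _), ofReal_norm] using h2
  have he : ENNReal.ofReal (2 ^ n * (n * h ^ 2)) = 2 ^ n * ENNReal.ofReal (n * h ^ 2) := by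
    rw [ENNReal.ofReal_mul (by positivity), ENNReal.ofReal_pow zero_le_two, ENNReal.ofReal_ofNat]
  refine ⟨fun k => φ (y k), ?_⟩
  calc ∑ k ∈ F, ∫⁻ x in gridCube h k, ‖φ x - φ (y k)‖ₑ ^ 2
      ≤ ∑ k ∈ F, (ENNReal.ofReal h ^ n)⁻¹ *
          ∫⁻ y in gridCube h k, ∫⁻ z in centredCube n h, ‖φ (y + z) - φ y‖ₑ ^ 2 := by
        refine Finset.sum_le_sum fun k _ => (hy k).trans ?_
        exact mul_le_mul' le_rfl (setLIntegral_mono' (measurableSet_gridCube h k) (hinner k))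
    _ = (ENNReal.ofReal h ^ n)⁻¹ * ∫⁻ y in ⋃ k ∈ F, gridCube h k,
          ∫⁻ z in centredCube n h, ‖φ (y + z) - φ y‖ₑ ^ 2 := by
        rw [← Finset.mul_sum, lintegral_biUnion_finset
          ((pairwise_disjoint_gridCube hh).set_pairwise _)
          fun k _ => measurableSet_gridCube h k]
    _ ≤ (ENNReal.ofReal h ^ n)⁻¹ * ∫⁻ y, ∫⁻ z in centredCube n h, ‖φ (y + z) - φ y‖ₑ ^ 2 := by
        gcongr
        exact Measure.restrict_le_self
    _ = (ENNReal.ofReal h ^ n)⁻¹ * ∫⁻ z in centredCube n h, ∫⁻ y, ‖φ (y + z) - φ y‖ₑ ^ 2 := by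
        rw [lintegral_lintegral_swap hm3.aemeasurable]
    _ ≤ (ENNReal.ofReal h ^ n)⁻¹ * ∫⁻ _ in centredCube n h,
          ENNReal.ofReal (n * h ^ 2) * ∑ i, ∫⁻ x, ‖PlateDomain.pderiv φ i x‖ₑ ^ 2 := by
        exact mul_le_mul' le_rfl (setLIntegral_mono' (measurableSet_centredCube h) hz)
    -- The centred cube has edge `2 h`, so dividing by the volume `h ^ n` of a grid cube leaves `2 ^
    -- n`.
    _ = _ := by
        rw [setLIntegral_const, volume_centredCube, mul_comm _ (2 ^ n * ENNReal.ofReal h ^ n),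
          mul_comm (2 ^ n : ℝ≥0∞), mul_assoc (ENNReal.ofReal h ^ n), ← mul_assoc _⁻¹,
          ENNReal.inv_mul_cancel hV0 hVt, one_mul, ← mul_assoc, he]

end Grid

/-! ### Compact operators on Hilbert spaces -/

section Compact

theorem norm_sub_starProjection_le_of_mem {H : Type*} [NormedAddCommGroup H]
    [InnerProductSpace ℂ H] {V : Submodule ℂ H} [V.HasOrthogonalProjection] (u : H)
    {w : H} (hw : w ∈ V) : ‖u - V.starProjection u‖ ≤ ‖u - w‖ := by
  rw [Submodule.starProjection_minimal]
  exact ciInf_le (f := fun w : V => ‖u - w‖)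
    ⟨0, by rintro _ ⟨w, rfl⟩; exact norm_nonneg _⟩ ⟨w, hw⟩

variable {H : Type*} [NormedAddCommGroup H] [InnerProductSpace ℂ H] [CompleteSpace H]

/-- A bounded operator that is approximated in norm by its compositions with orthogonal projections
of finite rank is compact. -/
theorem isCompactOperator_of_forall_exists_starProjection {K : Type*} [NormedAddCommGroup K]
    [NormedSpace ℂ K] (T : K →L[ℂ] H)
    (hT : ∀ ε : ℝ, 0 < ε → ∃ V : Submodule ℂ H, ∃ _ : FiniteDimensional ℂ V,
      ∀ x, ‖T x - V.starProjection (T x)‖ ≤ ε * ‖x‖) : IsCompactOperator T := by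
  refine isClosed_setOfPred_isCompactOperator.closure_subset (Metric.mem_closure_iff.2
    fun ε hε => ?_)
  obtain ⟨V, hV, hle⟩ := hT (ε / 2) (by positivity)
  refine ⟨V.starProjection.comp T, ?_, ?_⟩
  · have h1 : IsCompactOperator (V.orthogonalProjectionOnto.comp T) :=
      have := FiniteDimensional.proper ℂ V
      isCompactOperator_of_locallyCompactSpace_dom (V.orthogonalProjectionOnto.comp T)
    exact h1.clm_comp V.subtypeL
  · rw [dist_eq_norm]
    refine (ContinuousLinearMap.opNorm_le_bound _ (by positivity) fun x => ?_).trans_lt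
      (half_lt_self hε)
    exact hle x

/-- A compact symmetric operator has a Hilbert basis of eigenvectors. -/
theorem exists_hilbertBasis_eigenvectors.{u} {H : Type u} [NormedAddCommGroup H]
    [InnerProductSpace ℂ H] [CompleteSpace H] {R : H →L[ℂ] H} (hR : IsCompactOperator R)
    (hs : (R : H →ₗ[ℂ] H).IsSymmetric) :
    ∃ (ι : Type u) (b : HilbertBasis ι ℂ H) (μ : ι → ℝ), ∀ i, R (b i) = (μ i : ℂ) • b i := by
  let V : ℂ → Submodule ℂ H := fun μ => Module.End.eigenspace (R : H →ₗ[ℂ] H) μ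
  have hmem : ∀ μ x, x ∈ V μ ↔ R x = μ • x := fun μ x => Module.End.mem_eigenspace_iff
  have hcl : ∀ μ, IsClosed (V μ : Set H) := fun μ => by
    have : (V μ : Set H) = {x | R x = μ • x} := by ext x; exact hmem μ x
    rw [this]
    exact isClosed_eq R.continuous (continuous_const_smul μ)
  have hcomp : ∀ μ, CompleteSpace (V μ) := fun μ => (hcl μ).completeSpace_coe
  -- All complex `μ` are admitted; an eigenspace that is trivial contributes no basis vectors.
  choose w b hb using fun μ => exists_hilbertBasis ℂ (V μ)
  have horth := hs.orthogonalFamily_eigenspaces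
  have hon : Orthonormal ℂ fun a : Σ μ, w μ => ((b a.1 a.2 : V a.1) : H) :=
    horth.orthonormal_sigma_orthonormal (v_family := fun μ => b μ) fun μ => (b μ).orthonormal
  have htot : (Submodule.span ℂ (range fun a : Σ μ, w μ => ((b a.1 a.2 : V a.1) : H)))ᗮ = ⊥ := by
    rw [eq_bot_iff, ← ContinuousLinearMap.orthogonalComplement_iSup_eigenspaces_eq_bot hR hs]
    intro x hx
    rw [Submodule.mem_orthogonal'] at hx
    rw [← Submodule.iInf_orthogonal, Submodule.mem_iInf]
    intro μ
    rw [Submodule.mem_orthogonal']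
    intro y hy
    have hcl : IsClosed {y : V μ | ⟪x, (y : H)⟫_ℂ = 0} :=
      isClosed_eq (by fun_prop) continuous_const
    have hsub : (Submodule.span ℂ (range (b μ)) : Set (V μ)) ⊆ {y : V μ | ⟪x, (y : H)⟫_ℂ = 0} := by
      intro z hz
      refine Submodule.span_induction (p := fun (y : V μ) _ => ⟪x, (y : H)⟫_ℂ = 0) ?_ ?_ ?_ ?_ hz
      · rintro _ ⟨j, rfl⟩
        exact hx _ (Submodule.subset_span ⟨⟨μ, j⟩, rfl⟩)
      · simp
      · intro y z _ _ hy hz; simp [hy, hz]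
      · intro a y _ hy; simp [hy]
    have hd : (⟨y, hy⟩ : V μ) ∈ closure (Submodule.span ℂ (range (b μ)) : Set (V μ)) := by
      rw [← Submodule.topologicalClosure_coe, (b μ).dense_span]
      trivial
    exact closure_minimal hsub hcl hd
  refine ⟨Σ μ, w μ, HilbertBasis.mkOfOrthogonalEqBot hon htot, fun a => a.1.re, fun a => ?_⟩
  rw [HilbertBasis.coe_mkOfOrthogonalEqBot]
  have h1 : R ((b a.1 a.2 : V a.1) : H) = a.1 • ((b a.1 a.2 : V a.1) : H) :=
    (hmem _ _).1 (b a.1 a.2).2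
  have h2 : Module.End.HasEigenvalue (R : H →ₗ[ℂ] H) a.1 :=
    Module.End.hasEigenvalue_of_hasEigenvector ⟨(b a.1 a.2).2, hon.ne_zero a⟩
  rw [Complex.conj_eq_iff_re.1 (hs.conj_eigenvalue_eq_self h2)]
  exact h1

/-- The operator `J J†` and its weak characterization. -/
theorem exists_comp_adjoint {K : Type*} [NormedAddCommGroup K] [InnerProductSpace ℂ K]
    [CompleteSpace K] {J : K →L[ℂ] H} (hJ : IsCompactOperator J) :
    ∃ R : H →L[ℂ] H, IsCompactOperator R ∧ (R : H →ₗ[ℂ] H).IsSymmetric ∧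
      ∀ f x, R f = x ↔ ∃ k, J k = x ∧ ∀ k', ⟪k', k⟫_ℂ = ⟪J k', f⟫_ℂ := by
  refine ⟨J.comp (ContinuousLinearMap.adjoint J), hJ.comp_clm _, fun x y => ?_, fun f x => ?_⟩
  · change ⟪J (ContinuousLinearMap.adjoint J x), y⟫_ℂ = ⟪x, J (ContinuousLinearMap.adjoint J y)⟫_ℂ
    rw [← ContinuousLinearMap.adjoint_inner_right J, ContinuousLinearMap.adjoint_inner_left J]
  · constructor
    · exact fun h => ⟨ContinuousLinearMap.adjoint J f, h,
        fun k' => ContinuousLinearMap.adjoint_inner_right _ _ _⟩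
    · rintro ⟨k, rfl, hk⟩
      have : ContinuousLinearMap.adjoint J f = k := ext_inner_left ℂ fun k' => by
        rw [ContinuousLinearMap.adjoint_inner_right, hk]
      rw [← this]
      rfl

end Compact

/-! ### The spectrum of the Dirichlet Laplacian -/

namespace PlateDomain

variable {n : ℕ} (Ω : PlateDomain n)

variable {Ω} in
theorem enorm_sq_eq_lintegral (f : Ω.L2) : ‖f‖ₑ ^ 2 = ∫⁻ x in Ω.carrier, ‖f x‖ₑ ^ 2 := by
  rw [Lp.enorm_def]
  have := eLpNorm_nnreal_pow_eq_lintegral (μ := volume.restrict Ω.carrier) (f := f) (p := 2)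
    two_ne_zero
  simpa using this

instance : IsFiniteMeasure (volume.restrict Ω.carrier) :=
  ⟨by simpa using Ω.isBounded.measure_lt_top⟩

/-- The indicator function of a grid cube. -/
noncomputable def cubeIndicator (h : ℝ) (k : Fin n → ℤ) : Ω.L2 :=
  indicatorConstLp 2 (measurableSet_gridCube h k) (measure_ne_top _ _) 1

variable {Ω} in
-- The cubes are disjoint, so on each of them only its own term of the step function survives.
theorem enorm_sub_sum_cubeIndicator_sq_le {h : ℝ} (hpos : 0 < h) {F : Finset (Fin n → ℤ)}
    (hF : Ω.carrier ⊆ ⋃ k ∈ F, gridCube h k) (a : (Fin n → ℤ) → ℂ) {f : Ω.L2}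
    {φ : EuclideanSpace ℝ (Fin n) → ℂ} (hf : f =ᵐ[volume.restrict Ω.carrier] φ) :
    ‖f - ∑ k ∈ F, a k • Ω.cubeIndicator h k‖ₑ ^ 2 ≤
      ∑ k ∈ F, ∫⁻ x in gridCube h k, ‖φ x - a k‖ₑ ^ 2 := by
  have hae : (f - ∑ k ∈ F, a k • Ω.cubeIndicator h k : Ω.L2) =ᵐ[volume.restrict Ω.carrier]
      fun x => φ x - ∑ k ∈ F, a k * (gridCube h k).indicator (fun _ => (1 : ℂ)) x := by
    refine (Lp.coeFn_sub _ _).trans (hf.sub ?_)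
    refine (Lp.coeFn_finsetSum _ _).trans ?_
    have : ∀ k ∈ F, (a k • Ω.cubeIndicator h k : Ω.L2) =ᵐ[volume.restrict Ω.carrier]
        fun x => a k * (gridCube h k).indicator (fun _ => (1 : ℂ)) x := fun k _ =>
      (Lp.coeFn_smul _ _).trans (indicatorConstLp_coeFn.const_smul (a k))
    filter_upwards [(Finset.eventually_all F).2 this] with x hx
    rw [Finset.sum_apply]
    exact Finset.sum_congr rfl hx
  have hval : ∀ k ∈ F, ∀ x ∈ gridCube h k,
      ∑ k ∈ F, a k * (gridCube h k).indicator (fun _ => (1 : ℂ)) x = a k := fun k hk x hx => by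
    rw [Finset.sum_eq_single_of_mem k hk fun l _ hlk => ?_, indicator_of_mem hx, mul_one]
    rw [indicator_of_notMem, mul_zero]
    exact fun hl => Set.disjoint_left.1 (pairwise_disjoint_gridCube hpos hlk) hl hx
  rw [enorm_sq_eq_lintegral, lintegral_congr_ae (hae.mono fun x hx => by rw [hx])]
  refine (lintegral_mono_set hF).trans ?_
  rw [lintegral_biUnion_finset ((pairwise_disjoint_gridCube hpos).set_pairwise _)
    fun k _ => measurableSet_gridCube h k]
  refine Finset.sum_le_sum fun k hk => ?_
  refine setLIntegral_mono' (measurableSet_gridCube h k) fun x hx => ?_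
  simp only [hval k hk x hx, le_refl]

variable {Ω} in
-- Vanishing outside the domain lets the whole-space gradient integrals of the grid estimate be read
-- as norms in `L²(Ω)`.
theorem lintegral_enorm_sq_eq_of_tsupport_subset {f : Ω.L2} {φ : EuclideanSpace ℝ (Fin n) → ℂ}
    (hf : f =ᵐ[volume.restrict Ω.carrier] φ) (hφ : tsupport φ ⊆ Ω.carrier) :
    ∫⁻ x, ‖φ x‖ₑ ^ 2 = ‖f‖ₑ ^ 2 := by
  rw [enorm_sq_eq_lintegral, lintegral_congr_ae (hf.mono fun x hx => by rw [hx]),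
    ← lintegral_indicator Ω.isOpen.measurableSet]
  refine lintegral_congr fun x => ?_
  by_cases hx : x ∈ Ω.carrier
  · rw [indicator_of_mem hx]
  · rw [indicator_of_notMem hx, image_eq_zero_of_notMem_tsupport fun h => hx (hφ h)]
    simp

/-- On a fine grid, test functions are approximated by step functions. -/
theorem exists_norm_sub_sum_cubeIndicator_sq_le {h : ℝ} (hpos : 0 < h) {F : Finset (Fin n → ℤ)}
    (hF : Ω.carrier ⊆ ⋃ k ∈ F, gridCube h k) {p : Ω.L2 × (Fin n → Ω.L2)} (hp : p ∈ Ω.testGraph) :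
    ∃ a : (Fin n → ℤ) → ℂ, ‖p.1 - ∑ k ∈ F, a k • Ω.cubeIndicator h k‖ ^ 2 ≤
      2 ^ n * (n * h ^ 2) * ∑ i, ‖p.2 i‖ ^ 2 := by
  obtain ⟨φ, hφ, h1, h2⟩ := hp
  obtain ⟨a, ha⟩ := exists_gridCube_values (hφ.1.of_le (by simp)) hpos F
  refine ⟨a, ?_⟩
  have hfin := (enorm_sub_sum_cubeIndicator_sq_le hpos hF a h1).trans ha
  have hright : ∀ i, ∫⁻ x, ‖pderiv φ i x‖ₑ ^ 2 = ENNReal.ofReal (‖p.2 i‖ ^ 2) := fun i => by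
    rw [lintegral_enorm_sq_eq_of_tsupport_subset (h2 i) (hφ.pderiv i).2.2,
      ENNReal.ofReal_pow (norm_nonneg _), ofReal_norm]
  rw [Finset.sum_congr rfl fun i _ => hright i,
    ← ENNReal.ofReal_sum_of_nonneg fun i _ => sq_nonneg _,
    ← ENNReal.ofReal_mul (by positivity), ← ofReal_norm, ← ENNReal.ofReal_pow (norm_nonneg _)]
    at hfin
  exact (ENNReal.ofReal_le_ofReal_iff (by positivity)).1 hfin

/-- Functions in `H¹₀(Ω)` are approximated, uniformly on bounded sets, from finite-dimensional
subspaces. -/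
theorem exists_finiteDimensional_approx {ε : ℝ} (hε : 0 < ε) :
    ∃ V : Submodule ℂ Ω.L2, ∃ _ : FiniteDimensional ℂ V, ∀ p ∈ Ω.sobolevH10,
      ‖p.1 - V.starProjection p.1‖ ^ 2 ≤ ε * ∑ i, ‖p.2 i‖ ^ 2 := by
  obtain ⟨h, hpos, hle⟩ : ∃ h : ℝ, 0 < h ∧ 2 ^ n * (n * h ^ 2) ≤ ε := by
    -- The summand `+ 1` keeps the denominator nonzero when `n = 0`.
    refine ⟨√(ε / (2 ^ n * (n + 1))), Real.sqrt_pos.2 (by positivity), ?_⟩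
    rw [Real.sq_sqrt (by positivity)]
    calc (2 : ℝ) ^ n * (n * (ε / (2 ^ n * (n + 1)))) ≤
          2 ^ n * ((n + 1) * (ε / (2 ^ n * (n + 1)))) := by gcongr; linarith
      _ = ε := by field_simp
  obtain ⟨F, hF⟩ := exists_finset_gridCube Ω.isBounded hpos
  obtain ⟨V, hVe⟩ : ∃ V, V = Submodule.span ℂ (Ω.cubeIndicator h '' F) := ⟨_, rfl⟩
  have hV : FiniteDimensional ℂ V := by
    rw [hVe]
    exact FiniteDimensional.span_of_finite ℂ (F.finite_toSet.image _)
  refine ⟨V, hV, fun p hp => ?_⟩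
  have hcl : IsClosed {p : Ω.L2 × (Fin n → Ω.L2) |
      ‖p.1 - V.starProjection p.1‖ ^ 2 ≤ ε * ∑ i, ‖p.2 i‖ ^ 2} :=
    isClosed_le (by fun_prop) (by fun_prop)
  refine closure_minimal (s := (Ω.testGraph : Set (Ω.L2 × (Fin n → Ω.L2)))) ?_ hcl hp
  intro p hp
  obtain ⟨a, ha⟩ := Ω.exists_norm_sub_sum_cubeIndicator_sq_le hpos hF hp
  have hmem : ∀ k ∈ F, Ω.cubeIndicator h k ∈ V := fun k hk => by
    rw [hVe]
    exact Submodule.subset_span ⟨k, hk, rfl⟩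
  have hmin : ‖p.1 - V.starProjection p.1‖ ≤ ‖p.1 - ∑ k ∈ F, a k • Ω.cubeIndicator h k‖ := by
    exact norm_sub_starProjection_le_of_mem p.1
      (Submodule.sum_mem _ fun k hk => Submodule.smul_mem _ _ (hmem k hk))
  exact (pow_le_pow_left₀ (norm_nonneg _) hmin 2).trans (ha.trans
    (mul_le_mul_of_nonneg_right hle (Finset.sum_nonneg fun i _ => sq_nonneg _)))

/-- `L²(Ω)` is infinite-dimensional. -/
theorem not_finiteDimensional_L2 [NeZero n] : ¬ FiniteDimensional ℂ Ω.L2 := by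
  intro hfin
  -- Here `n ≥ 1` enters: points are not isolated. An infinite Hausdorff space contains infinitely
  -- many disjoint nonempty open sets, whose indicators are orthogonal and nonzero.
  have hinf : Infinite Ω.carrier := by
    obtain ⟨x, hx⟩ := Ω.nonempty
    exact (infinite_of_mem_nhds x (Ω.isOpen.mem_nhds hx)).to_subtype
  obtain ⟨U, hU1, hU2, hU3⟩ := exists_seq_infinite_isOpen_pairwise_disjoint Ω.carrier
  let O : ℕ → Set (EuclideanSpace ℝ (Fin n)) := fun k => (↑) '' U k
  have hO : ∀ k, IsOpen (O k) := fun k => Ω.isOpen.isOpenMap_subtype_val _ (hU2 k)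
  have hsub : ∀ k, O k ⊆ Ω.carrier := fun k => by rintro _ ⟨y, -, rfl⟩; exact y.2
  let v : ℕ → Ω.L2 := fun k =>
    indicatorConstLp 2 (hO k).measurableSet (measure_ne_top _ _) 1
  have hinner : ∀ k l, ⟪v k, v l⟫_ℂ =
      ((volume.restrict Ω.carrier).real (O k ∩ O l) : ℂ) := fun k l => by
    rw [L2.inner_indicatorConstLp_indicatorConstLp]
    simp
  have hv : LinearIndependent ℂ v := by
    refine linearIndependent_of_ne_zero_of_inner_eq_zero (fun k h0 => ?_) fun k l hkl => ?_
    · have h1 := hinner k k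
      rw [h0, inner_zero_left, inter_self, eq_comm, Complex.ofReal_eq_zero,
        measureReal_eq_zero_iff, Measure.restrict_eq_self _ (hsub k)] at h1
      exact ((hO k).measure_pos volume ((hU1 k).nonempty.image _)).ne' h1
    · have : O k ∩ O l = ∅ := by
        rw [← Set.disjoint_iff_inter_eq_empty]
        exact (Set.disjoint_image_iff Subtype.val_injective).2 (hU3 hkl)
      change ⟪v k, v l⟫_ℂ = 0
      rw [hinner, this]
      simp
  exact Module.Finite.not_linearIndependent_of_infinite v hv

end PlateDomain

/-! ### The Hilbert space `H¹₀(Ω)`, the resolvent and the eigenbasis -/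

namespace PlateDomain

variable {n : ℕ} (Ω : PlateDomain n)

/-- The Hilbert space `L²(Ω) × L²(Ω)ⁿ`. -/
abbrev GradL2 : Type := WithLp 2 (Ω.L2 × PiLp 2 fun _ : Fin n => Ω.L2)

/-- `H¹₀(Ω)` as a subspace of the Hilbert space `L²(Ω) × L²(Ω)ⁿ`. -/
noncomputable def hilbertH10 : Submodule ℂ Ω.GradL2 where
  carrier := {p | (p.fst, fun i => p.snd i) ∈ Ω.sobolevH10}
  add_mem' hp hq := Ω.sobolevH10.add_mem hp hq
  zero_mem' := Ω.sobolevH10.zero_mem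
  smul_mem' a _ hp := Ω.sobolevH10.smul_mem a hp

theorem isClosed_hilbertH10 : IsClosed (Ω.hilbertH10 : Set Ω.GradL2) := by
  have hc : Continuous fun p : Ω.GradL2 => (p.fst, fun i => p.snd i) := by fun_prop
  exact (Submodule.isClosed_topologicalClosure Ω.testGraph).preimage hc

/-- The Hilbert space `H¹₀(Ω)`. -/
def H10 : Type := Ω.hilbertH10

noncomputable instance : NormedAddCommGroup Ω.H10 :=
  inferInstanceAs (NormedAddCommGroup Ω.hilbertH10)

noncomputable instance : InnerProductSpace ℂ Ω.H10 :=
  inferInstanceAs (InnerProductSpace ℂ Ω.hilbertH10)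

instance : CompleteSpace Ω.H10 := Ω.isClosed_hilbertH10.completeSpace_coe

/-- The inclusion of `H¹₀(Ω)` in `L²(Ω) × L²(Ω)ⁿ`. -/
noncomputable def H10.toGradL2 : Ω.H10 →ₗᵢ[ℂ] Ω.GradL2 := Ω.hilbertH10.subtypeₗᵢ

theorem H10.toGradL2_mem (p : Ω.H10) :
    ((H10.toGradL2 Ω p).fst, fun i => (H10.toGradL2 Ω p).snd i) ∈ Ω.sobolevH10 :=
  Subtype.property (p := (· ∈ Ω.hilbertH10)) p

theorem H10.exists_toGradL2_eq {p : Ω.L2 × (Fin n → Ω.L2)} (hp : p ∈ Ω.sobolevH10) :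
    ∃ k : Ω.H10, H10.toGradL2 Ω k = WithLp.toLp 2 (p.1, WithLp.toLp 2 p.2) :=
  ⟨(⟨WithLp.toLp 2 (p.1, WithLp.toLp 2 p.2), hp⟩ : Ω.hilbertH10), rfl⟩

theorem gradL2_inner (p q : Ω.GradL2) :
    ⟪p, q⟫_ℂ = ⟪p.fst, q.fst⟫_ℂ + ∑ i, ⟪p.snd i, q.snd i⟫_ℂ := by
  rw [WithLp.prod_inner_apply, PiLp.inner_apply]
  rfl

theorem gradL2_norm_sq (p : Ω.GradL2) : ‖p‖ ^ 2 = ‖p.fst‖ ^ 2 + ∑ i, ‖p.snd i‖ ^ 2 := by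
  rw [WithLp.prod_norm_sq_eq_of_L2, PiLp.norm_sq_eq_of_L2]

/-- The inclusion of `H¹₀(Ω)` in `L²(Ω)`. -/
noncomputable def inclH10 : Ω.H10 →L[ℂ] Ω.L2 :=
  LinearMap.mkContinuous
    { toFun := fun p => (H10.toGradL2 Ω p).fst
      map_add' := fun p q => by rw [map_add]; rfl
      map_smul' := fun a p => by rw [map_smul]; rfl } 1 fun p => by
    rw [one_mul, ← (H10.toGradL2 Ω).norm_map p]
    refine (pow_le_pow_iff_left₀ (norm_nonneg _) (norm_nonneg _) two_ne_zero).1 ?_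
    rw [gradL2_norm_sq]
    exact le_add_of_nonneg_right (Finset.sum_nonneg fun i _ => sq_nonneg _)

theorem inclH10_apply (p : Ω.H10) : Ω.inclH10 p = (H10.toGradL2 Ω p).fst := rfl

/-- Rellich's theorem: the inclusion of `H¹₀(Ω)` in `L²(Ω)` is compact. -/
theorem isCompactOperator_inclH10 : IsCompactOperator Ω.inclH10 := by
  refine isCompactOperator_of_forall_exists_starProjection _ fun ε hε => ?_
  obtain ⟨V, hV, hle⟩ := Ω.exists_finiteDimensional_approx (sq_pos_of_pos hε)
  refine ⟨V, hV, fun p => ?_⟩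
  have h1 := hle _ (H10.toGradL2_mem Ω p)
  have h2 : ∑ i, ‖(H10.toGradL2 Ω p).snd i‖ ^ 2 ≤ ‖p‖ ^ 2 := by
    rw [← (H10.toGradL2 Ω).norm_map p, gradL2_norm_sq]
    exact le_add_of_nonneg_left (sq_nonneg _)
  have h3 := h1.trans (mul_le_mul_of_nonneg_left h2 (sq_nonneg ε))
  rw [← mul_pow] at h3
  exact (pow_le_pow_iff_left₀ (norm_nonneg _) (by positivity) two_ne_zero).1 h3

/-- The weak equation for elements of the Laplace graph holds for all test functions in
`H¹₀(Ω)`. -/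
theorem sum_inner_grad_eq {f : Ω.L2} {G : Fin n → Ω.L2}
    (h : ∀ q ∈ Ω.testGraph, ∑ i, ⟪q.2 i, G i⟫_ℂ = ⟪q.1, f⟫_ℂ) {q : Ω.L2 × (Fin n → Ω.L2)}
    (hq : q ∈ Ω.sobolevH10) : ∑ i, ⟪q.2 i, G i⟫_ℂ = ⟪q.1, f⟫_ℂ := by
  have hcl : IsClosed {q : Ω.L2 × (Fin n → Ω.L2) | ∑ i, ⟪q.2 i, G i⟫_ℂ = ⟪q.1, f⟫_ℂ} :=
    isClosed_eq (by fun_prop) (by fun_prop)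
  exact closure_minimal (s := (Ω.testGraph : Set (Ω.L2 × (Fin n → Ω.L2)))) h hcl hq

/-- The resolvent `(A + 1)⁻¹` of the Dirichlet Laplacian is compact and symmetric. -/
theorem exists_resolvent : ∃ R : Ω.L2 →L[ℂ] Ω.L2, IsCompactOperator R ∧
    (R : Ω.L2 →ₗ[ℂ] Ω.L2).IsSymmetric ∧ ∀ x y, (x, y) ∈ Ω.laplaceGraph ↔ R (x + y) = x := by
  -- With the `H¹` inner product, `J J†` for the inclusion `J` solves `-Δx + x = f` weakly. For `f =
  -- x + y` the zero-order terms cancel, and what remains is the weak form of `-Δx = y`.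
  obtain ⟨R, hc, hs, hR⟩ := exists_comp_adjoint Ω.isCompactOperator_inclH10
  refine ⟨R, hc, hs, fun x y => ?_⟩
  rw [hR]
  constructor
  · rintro ⟨G, hG, h⟩
    obtain ⟨k, hk⟩ := H10.exists_toGradL2_eq Ω hG
    refine ⟨k, by rw [inclH10_apply, hk]; rfl, fun k' => ?_⟩
    rw [← (H10.toGradL2 Ω).inner_map_map, gradL2_inner, inclH10_apply, inner_add_right, hk]
    congr 1
    exact Ω.sum_inner_grad_eq h (H10.toGradL2_mem Ω k')
  · rintro ⟨k, hx, h⟩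
    rw [inclH10_apply] at hx
    refine ⟨fun i => (H10.toGradL2 Ω k).snd i, hx ▸ H10.toGradL2_mem Ω k, fun q hq => ?_⟩
    obtain ⟨k', hk'⟩ := H10.exists_toGradL2_eq Ω (subset_closure hq)
    have h1 := h k'
    rw [← (H10.toGradL2 Ω).inner_map_map, gradL2_inner, hx, inclH10_apply, inner_add_right,
      hk'] at h1
    exact add_left_cancel h1

/-- The Dirichlet Laplacian is bounded below. -/
theorem exists_lower_bound [NeZero n] : ∃ δ : ℝ, 0 < δ ∧ ∀ p ∈ Ω.laplaceGraph,
    δ * ‖p.1‖ ^ 2 ≤ (⟪p.1, p.2⟫_ℂ).re := by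
  obtain ⟨C, hC⟩ := Ω.friedrichs 0
  refine ⟨(C ^ 2 + 1)⁻¹, by positivity, ?_⟩
  rintro p ⟨G, hG, h⟩
  have h1 := congrArg Complex.re (Ω.sum_inner_grad_eq h hG)
  rw [← h1]
  have h2 : (∑ i, ⟪G i, G i⟫_ℂ).re = ∑ i, ‖G i‖ ^ 2 := by
    simp [inner_self_eq_norm_sq_to_K, ← Complex.ofReal_pow]
  rw [h2, inv_mul_le_iff₀ (by positivity)]
  have h3 : ‖p.1‖ ^ 2 ≤ C ^ 2 * ‖G 0‖ ^ 2 := by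
    rw [← mul_pow]; exact pow_le_pow_left₀ (norm_nonneg _) (hC _ hG) 2
  have h4 : ‖G 0‖ ^ 2 ≤ ∑ i, ‖G i‖ ^ 2 :=
    Finset.single_le_sum (f := fun i => ‖G i‖ ^ 2) (fun i _ => sq_nonneg _) (Finset.mem_univ 0)
  calc ‖p.1‖ ^ 2 ≤ C ^ 2 * ‖G 0‖ ^ 2 := h3
    _ ≤ (C ^ 2 + 1) * ∑ i, ‖G i‖ ^ 2 := by gcongr; linarith

/-- The Dirichlet Laplacian is diagonal in a Hilbert basis, with unbounded eigenvalues. -/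
theorem exists_isDiagonal [NeZero n] : ∃ (ι : Type) (b : HilbertBasis ι ℂ Ω.L2) (ev : ι → ℝ),
    Ω.dirichletLaplacian.IsDiagonal b ev ∧ ¬ BddAbove (range ev) := by
  obtain ⟨R, hRc, hRs, hR⟩ := Ω.exists_resolvent
  obtain ⟨ι, b, μ, hμ⟩ := exists_hilbertBasis_eigenvectors hRc hRs
  obtain ⟨δ, hδ, hle⟩ := Ω.exists_lower_bound
  have hb : ∀ i, ‖b i‖ = 1 := b.orthonormal.1
  -- A kernel vector `f` of `R` would give the pair `(0, f)` in the Laplace graph, which is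
  -- single-valued.
  have hμ0 : ∀ i, μ i ≠ 0 := fun i h0 => by
    have h1 : ((0 : Ω.L2), b i) ∈ Ω.laplaceGraph := by
      rw [hR, zero_add, hμ, h0, Complex.ofReal_zero, zero_smul]
    have h2 : b i = 0 := Ω.laplaceGraph_snd_eq_zero _ h1 rfl
    have h3 := hb i
    rw [h2, norm_zero] at h3
    exact zero_ne_one h3
  -- Since `R = (A + 1)⁻¹`, an eigenvalue `μ` of `R` corresponds to `μ⁻¹ - 1` for `A`; the lower
  -- bound is that of the quadratic form.
  have hlow : ∀ i, δ ≤ (μ i)⁻¹ - 1 := fun i => by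
    have hne : (μ i : ℂ) ≠ 0 := by exact_mod_cast hμ0 i
    have h1 : (b i, (((μ i)⁻¹ - 1 : ℝ) : ℂ) • b i) ∈ Ω.laplaceGraph := by
      rw [hR, map_add, map_smul, hμ, smul_smul, ← add_smul]
      conv_rhs => rw [← one_smul ℂ (b i)]
      congr 1
      push_cast
      field_simp
      ring
    have h2 := hle _ h1
    simp only [hb, inner_smul_right, inner_self_eq_norm_sq_to_K] at h2
    simpa using h2
  have hpos : ∀ i, 0 < μ i := fun i => inv_pos.1 (by have := hlow i; linarith)
  have hrepr : ∀ x i, b.repr (R x) i = μ i * b.repr x i := fun x i => by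
    have h1 := hRs (b i) x
    rw [ContinuousLinearMap.coe_coe, hμ, inner_smul_left, Complex.conj_ofReal] at h1
    rw [b.repr_apply_apply, b.repr_apply_apply, h1]
  refine ⟨ι, b, fun i => (μ i)⁻¹ - 1, ⟨⟨δ, hδ, hlow⟩, fun x y => ?_⟩, ?_⟩
  · rw [mem_graph_dirichletLaplacian, hR]
    have hpt : ∀ i, b.repr (R (x + y)) i = b.repr x i ↔
        b.repr y i = (((μ i)⁻¹ - 1 : ℝ) : ℂ) * b.repr x i := fun i => by
      have hne : (μ i : ℂ) ≠ 0 := by exact_mod_cast hμ0 i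
      rw [hrepr, b.repr_add_apply]
      push_cast
      constructor
      · intro h
        refine mul_left_cancel₀ hne ?_
        linear_combination h - b.repr x i * mul_inv_cancel₀ hne
      · intro h
        rw [h]
        linear_combination b.repr x i * mul_inv_cancel₀ hne
    constructor
    · intro h i
      exact (hpt i).1 (by rw [h])
    · intro h
      exact b.ext_repr fun i => (hpt i).2 (h i)
  · rintro ⟨C, hC⟩
    have hC' : ∀ i, (μ i)⁻¹ ≤ C + 1 := fun i => by
      have : (μ i)⁻¹ - 1 ≤ C := hC ⟨i, rfl⟩
      linarith
    -- Bounded eigenvalues would make `R` boundedly invertible. The unit ball would lie in the image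
    -- of a ball under a compact operator, so the identity would be compact and the space
    -- finite-dimensional.
    refine Ω.not_finiteDimensional_L2 (FiniteDimensional.of_isCompactOperator_id (𝕜 := ℂ) ?_)
    obtain ⟨K, hK, hsub⟩ :=
      hRc.image_closedBall_subset_compact (f := (R : Ω.L2 →ₗ[ℂ] Ω.L2)) (|C + 1| * 1)
    refine ⟨K, hK, mem_of_superset (Metric.closedBall_mem_nhds (0 : Ω.L2) one_pos) fun y hy => ?_⟩
    rw [mem_closedBall_zero_iff] at hy
    have hbd : ∀ i, ‖(((μ i)⁻¹ : ℝ) : ℂ) * b.repr y i‖ ≤ |C + 1| * ‖b.repr y i‖ := fun i => by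
      rw [norm_mul, Complex.norm_real, Real.norm_of_nonneg (inv_nonneg.2 (hpos i).le)]
      gcongr
      exact (hC' i).trans (le_abs_self _)
    obtain ⟨x, hx⟩ := b.exists_repr_eq_of_le y |C + 1| hbd
    refine hsub ⟨x, ?_, b.ext_repr fun i => ?_⟩
    · rw [mem_closedBall_zero_iff]
      have h1 : ‖x‖ ≤ ‖((|C + 1| : ℝ) : ℂ) • y‖ := by
        rw [← b.repr.norm_map, ← b.repr.norm_map (_ • y)]
        refine lp.norm_mono (by norm_num) fun i => ?_
        rw [hx, b.repr_smul_apply]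
        refine (hbd i).trans_eq ?_
        rw [norm_mul, Complex.norm_real, Real.norm_eq_abs, abs_abs]
      refine h1.trans ?_
      rw [norm_smul, Complex.norm_real, Real.norm_eq_abs, abs_abs]
      gcongr
    · have hne : (μ i : ℂ) ≠ 0 := by exact_mod_cast hμ0 i
      rw [ContinuousLinearMap.coe_coe, hrepr, hx, Complex.ofReal_inv, mul_inv_cancel_left₀ hne]

end PlateDomain

theorem theorem8 {n : ℕ} [NeZero n] (Ω : PlateDomain n) (c : PlateCoefficients)
    (τ : ℝ) (hτ : τ ∈ Set.Ioc (0 : ℝ) 1) :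
    (∃ S : StronglyContinuousSemigroup (PlateState Ω.dirichletLaplacian c τ),
      S.IsGeneratedBy (plateOperator Ω.dirichletLaplacian c τ)) ∧
    ∀ S : StronglyContinuousSemigroup (PlateState Ω.dirichletLaplacian c τ),
      S.IsGeneratedBy (plateOperator Ω.dirichletLaplacian c τ) → ¬ S.IsAnalytic := by
  obtain ⟨ι, b, ev, h, hev⟩ := Ω.exists_isDiagonal
  exact ⟨exists_plateSemigroup h c hτ.1.le,
    fun S hS => plateSemigroup_not_isAnalytic h hev c hτ S hS⟩
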